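/- **Notation.** A function $b:(0,\infty)\to(0,\infty)$ is *slowly varying*, $b\in SV(0,\infty)$, if it is Lebesgue measurable and for every $\varepsilon>0$ the function $t^{\varepsilon}b(t)$ is equivalent to a non-decreasing function on $(0,\infty)$ and $t^{-\varepsilon}b(t)$ is equivalent to a non-increasing function on $(0,\infty)$ (two non-negative functions are equivalent if each is at most a positive constant times the other). $AC(0,\infty)$ is the set of real functions on $(0,\infty)$ that are absolutely continuous on every compact subinterval of $(0,\infty)$. For a monotone $f$ on $(0,\infty)$ put $f(0)=\lim_{t\to0+}f(t)$ and $f(\infty)=\lim_{t\to\infty}f(t)$. A *compatible couple* $(X_0,X_1)$ consists of two (real or complex) Banach spaces continuously embedded in a common Hausdorff topological vector space. The norms on $X_0\cap X_1$ and $X_0+X_1$ are $\|f\|_{X_0\cap X_1}=\max\{\|f\|_{X_0},\|f\|_{X_1}\}$ and $\|f\|_{X_0+X_1}=\inf\{\|f_0\|_{X_0}+\|f_1\|_{X_1}: f=f_0+f_1\}$. For $t>0$ let $$K(f,t;X_0,X_1)=\inf\{\|f_0\|_{X_0}+t\|f_1\|_{X_1}:\ f=f_0+f_1,\ f_0\in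 X_0,\ f_1\in X_1\}\quad(f\in X_0+X_1),$$ $$J(f,t;X_0,X_1)=\max\{\|f\|_{X_0},\,t\|f\|_{X_1}\}\quad(f\in X_0\cap X_1).$$ For a measurable weight $v\ge 0$ that is finite a.e. on $(0,\infty)$, the space $(X_0,X_1)_{0,1,v;K}$ consists of all $f\in X_0+X_1$ with $$\|f\|_{0,1,v;K}=\int_0^\infty v(t)\,K(f,t;X_0,X_1)\,\frac{dt}{t}<\infty ,$$ and $(X_0,X_1)_{0,1,v;J}$ consists of all $f\in X_0+X_1$ that have a representation $f=\int_0^\infty u(s)\,\frac{ds}{s}$ (Bochner integral in $X_0+X_1$) with a strongly measurable $u:(0,\infty)\to X_0\cap X_1$ and for which $$\|f\|_{0,1,v;J}=\inf_u\int_0^\infty v(t)\,J(u(t),t;X_0,X_1)\,\frac{dt}{t}<\infty ,$$ the infimum being taken over all such representations. An equality between such spaces means that they have the same elements and that their norms are equivalent. **Theorem.** Let $(X_0,X_1)$ be a compatible couple and let $a\in SV(0,\infty)\cap AC(0,\infty)$ be strictly decreasing with $a(0)=\infty$ and $a(\infty)>0$. Let $\alpha\in SV(0,\infty)\cap AC(0,\infty)$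 be strictly decreasing with $\alpha(0)=\infty$ and $\alpha(\infty)=0$. Put $$A(x)=a(x)\ \text{ for } x\in(0,1],\qquad A(x)=c\,\alpha(x)\ \text{ for } x\in(1,\infty),$$ where $c>0$ is a constant chosen so that $A\in AC(0,\infty)$, and let $$B(x)=-x\,A'(x)\quad\text{for a.a. } x>0 .$$ Then $$(X_0,X_1)_{0,1,a;J}=(X_0,X_0\cap X_1)_{0,1,A;J}=(X_0,X_0\cap X_1)_{0,1,B;K}.$$ -/

import Mathlib

open MeasureTheory Set Filter
open scoped ENNReal NNReal Topology

noncomputable section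

namespace LimitingInterpolation

/-! ### Slowly varying and absolutely continuous functions on `(0, ∞)`

Functions on `(0, ∞)` are functions `ℝ → ℝ` of which only the values on `Set.Ioi 0` matter. -/

/-- Two non-negative functions are equivalent on `(0, ∞)`: each is bounded by a positive constant
times the other one. -/
def EquivOnPos (f g : ℝ → ℝ) : Prop :=
  ∃ c C : ℝ, 0 < c ∧ 0 < C ∧ ∀ t : ℝ, 0 < t → c * g t ≤ f t ∧ f t ≤ C * g t

/-- `b ∈ SV(0, ∞)`: `b` is positive and Lebesgue measurable on `(0, ∞)` and, for every `ε > 0`,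
`t ^ ε * b t` is equivalent to a non-decreasing function and `t ^ (-ε) * b t` is equivalent to a
non-increasing function on `(0, ∞)`. -/
structure SlowlyVarying (b : ℝ → ℝ) : Prop where
  pos : ∀ t : ℝ, 0 < t → 0 < b t
  aemeasurable : AEMeasurable b (volume.restrict (Ioi (0 : ℝ)))
  equiv_monotone : ∀ ε : ℝ, 0 < ε →
    ∃ φ : ℝ → ℝ, MonotoneOn φ (Ioi (0 : ℝ)) ∧ EquivOnPos (fun t => t ^ ε * b t) φ
  equiv_antitone : ∀ ε : ℝ, 0 < ε →
    ∃ ψ : ℝ → ℝ, AntitoneOn ψ (Ioi (0 : ℝ)) ∧ EquivOnPos (fun t => t ^ (-ε) * b t) ψ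

/-- `f ∈ AC(0, ∞)`: `f` is absolutely continuous on every compact subinterval of `(0, ∞)`. -/
def AbsContOnPos (f : ℝ → ℝ) : Prop :=
  ∀ x y : ℝ, 0 < x → x ≤ y → AbsolutelyContinuousOnInterval f x y

/-! ### Compatible couples

A couple is given by two normed spaces `X₀`, `X₁` together with continuous linear maps `i₀`, `i₁`
into a common Hausdorff topological vector space `V`. It is a compatible couple in the usual sense
if `X₀` and `X₁` are complete and `i₀`, `i₁` are injective, that is, if `X₀` and `X₁` are Banach
spaces that are continuously embedded in `V`. All interpolation spaces of the couple are subsets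
of `V`, so that spaces coming from different couples in the same `V` can be compared. -/

section Couple

variable {𝕜 : Type*} [RCLike 𝕜]
  {V : Type*} [AddCommGroup V] [Module 𝕜 V] [TopologicalSpace V] [IsTopologicalAddGroup V]
  [ContinuousSMul 𝕜 V] [T2Space V]
  {X₀ : Type*} [NormedAddCommGroup X₀] [NormedSpace 𝕜 X₀]
  {X₁ : Type*} [NormedAddCommGroup X₁] [NormedSpace 𝕜 X₁]

/-- The pairs `(x₀, x₁)` which represent one and the same element `i₀ x₀ = i₁ x₁` of `V`. -/
def interSubmodule (i₀ : X₀ →L[𝕜] V) (i₁ : X₁ →L[𝕜] V) : Submodule 𝕜 (X₀ × X₁) :=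
  LinearMap.eqLocus (i₀.comp (ContinuousLinearMap.fst 𝕜 X₀ X₁)).toLinearMap
    (i₁.comp (ContinuousLinearMap.snd 𝕜 X₀ X₁)).toLinearMap

/-- The intersection `X₀ ∩ X₁`. Its norm is inherited from the product `X₀ × X₁`, that is,
`‖f‖ = max ‖f‖_{X₀} ‖f‖_{X₁}`. -/
abbrev InterSpace (i₀ : X₀ →L[𝕜] V) (i₁ : X₁ →L[𝕜] V) : Type _ := ↥(interSubmodule i₀ i₁)

/-- The embedding of `X₀ ∩ X₁` into `V`. -/
def interIncl (i₀ : X₀ →L[𝕜] V) (i₁ : X₁ →L[𝕜] V) : InterSpace i₀ i₁ →L[𝕜] V :=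
  (i₀.comp (ContinuousLinearMap.fst 𝕜 X₀ X₁)).comp (interSubmodule i₀ i₁).subtypeL

/-- The map `(x₀, x₁) ↦ i₀ x₀ + i₁ x₁`, where `X₀ × X₁` carries the norm `‖x₀‖ + ‖x₁‖`. -/
def sumMap (i₀ : X₀ →L[𝕜] V) (i₁ : X₁ →L[𝕜] V) : WithLp 1 (X₀ × X₁) →L[𝕜] V :=
  (i₀.coprod i₁).comp (WithLp.prodContinuousLinearEquiv 1 𝕜 X₀ X₁).toContinuousLinearMap

/-- The sum `X₀ + X₁`, as the quotient of `X₀ × X₁` (with norm `‖x₀‖ + ‖x₁‖`) by the pairs that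
represent `0`. Its norm is the quotient norm, that is,
`‖f‖ = inf {‖x₀‖ + ‖x₁‖ : f = x₀ + x₁}`. -/
abbrev SumSpace (i₀ : X₀ →L[𝕜] V) (i₁ : X₁ →L[𝕜] V) : Type _ :=
  WithLp 1 (X₀ × X₁) ⧸ (sumMap i₀ i₁).ker

instance isClosed_ker_sumMap (i₀ : X₀ →L[𝕜] V) (i₁ : X₁ →L[𝕜] V) :
    IsClosed ((sumMap i₀ i₁).ker : Set (WithLp 1 (X₀ × X₁))) :=
  (sumMap i₀ i₁).isClosed_ker

/-- `X₀ + X₁` as a real normed space, by restriction of scalars. -/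
instance sumSpaceNormedSpaceReal (i₀ : X₀ →L[𝕜] V) (i₁ : X₁ →L[𝕜] V) :
    NormedSpace ℝ (SumSpace i₀ i₁) :=
  NormedSpace.restrictScalars ℝ 𝕜 (SumSpace i₀ i₁)

/-- The embedding of `X₀ + X₁` into `V`. -/
def sumIncl (i₀ : X₀ →L[𝕜] V) (i₁ : X₁ →L[𝕜] V) : SumSpace i₀ i₁ →ₗ[𝕜] V :=
  (sumMap i₀ i₁).ker.liftQ (sumMap i₀ i₁).toLinearMap le_rfl

/-- The inclusion of `X₀ ∩ X₁` into `X₀ + X₁`, given by `f ↦ f + 0`. -/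
def interToSum (i₀ : X₀ →L[𝕜] V) (i₁ : X₁ →L[𝕜] V) (f : InterSpace i₀ i₁) : SumSpace i₀ i₁ :=
  (sumMap i₀ i₁).ker.mkQ (WithLp.toLp 1 (f.1.1, (0 : X₁)))

/-! ### The functionals of Peetre and the interpolation spaces -/

/-- The `K`-functional `K(f, t; X₀, X₁) = inf {‖f₀‖ + t ‖f₁‖ : f = f₀ + f₁}`, with values in
`[0, ∞]`. It is finite exactly if `f ∈ X₀ + X₁`. -/
def peetreK (i₀ : X₀ →L[𝕜] V) (i₁ : X₁ →L[𝕜] V) (f : V) (t : ℝ) : ℝ≥0∞ :=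
  ⨅ (x : X₀ × X₁) (_ : i₀ x.1 + i₁ x.2 = f), ‖x.1‖ₑ + ENNReal.ofReal t * ‖x.2‖ₑ

/-- The `J`-functional `J(f, t; X₀, X₁) = max {‖f‖_{X₀}, t ‖f‖_{X₁}}` of `f ∈ X₀ ∩ X₁`. -/
def peetreJ (i₀ : X₀ →L[𝕜] V) (i₁ : X₁ →L[𝕜] V) (f : InterSpace i₀ i₁) (t : ℝ) : ℝ≥0∞ :=
  max ‖f.1.1‖ₑ (ENNReal.ofReal t * ‖f.1.2‖ₑ)

/-- The functional `‖t ^ (-θ - 1/q) v(t) F(t)‖_{q, (0, ∞)}` with the usual `L_q`-norm on `(0, ∞)`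
(here `1/q = 0` for `q = ∞`). -/
def weightedNorm (θ : ℝ) (q : ℝ≥0∞) (v : ℝ → ℝ) (F : ℝ → ℝ≥0∞) : ℝ≥0∞ :=
  eLpNorm (fun t : ℝ => ENNReal.ofReal (t ^ (-θ - q⁻¹.toReal) * v t) * F t) q
    (volume.restrict (Ioi (0 : ℝ)))

/-- `f = ∫_0^∞ u(s) ds/s` for a strongly measurable `u : (0, ∞) → X₀ ∩ X₁`, where the integral
converges in `X₀ + X₁` (as a Bochner integral). -/
structure IsRepresentation (i₀ : X₀ →L[𝕜] V) (i₁ : X₁ →L[𝕜] V) (f : V)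
    (u : ℝ → InterSpace i₀ i₁) : Prop where
  stronglyMeasurable : AEStronglyMeasurable u (volume.restrict (Ioi (0 : ℝ)))
  integrable : IntegrableOn (fun s : ℝ => s⁻¹ • interToSum i₀ i₁ (u s)) (Ioi (0 : ℝ)) volume
  eq_integral : sumIncl i₀ i₁ (∫ s in Ioi (0 : ℝ), s⁻¹ • interToSum i₀ i₁ (u s)) = f

end Couple

/-- A subset of `V` together with a functional `V → [0, ∞]`, of which only the values on the subset
matter. The spaces `(X₀, X₁)_{θ,q,v;K}` and `(X₀, X₁)_{θ,q,v;J}` are of this kind. -/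
structure FunctionalSpace (V : Type*) where
  /-- the underlying set -/
  carrier : Set V
  /-- the (quasi-)norm -/
  functional : V → ℝ≥0∞

/-- Two spaces coincide: they have the same elements, and their norms are equivalent. -/
def FunctionalSpace.Coincides {V : Type*} (Y Z : FunctionalSpace V) : Prop :=
  Y.carrier = Z.carrier ∧ ∃ C : ℝ≥0, ∀ f ∈ Y.carrier,
    Y.functional f ≤ C * Z.functional f ∧ Z.functional f ≤ C * Y.functional f

section Spaces

variable {𝕜 : Type*} [RCLike 𝕜]
  {V : Type*} [AddCommGroup V] [Module 𝕜 V] [TopologicalSpace V] [IsTopologicalAddGroup V]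
  [ContinuousSMul 𝕜 V] [T2Space V]
  {X₀ : Type*} [NormedAddCommGroup X₀] [NormedSpace 𝕜 X₀]
  {X₁ : Type*} [NormedAddCommGroup X₁] [NormedSpace 𝕜 X₁]

/-- The space `(X₀, X₁)_{θ,q,v;K}` of all `f ∈ X₀ + X₁` such that
`‖f‖_{θ,q,v;K} = ‖t ^ (-θ - 1/q) v(t) K(f, t; X₀, X₁)‖_{q, (0, ∞)}` is finite. -/
def kSpace (i₀ : X₀ →L[𝕜] V) (i₁ : X₁ →L[𝕜] V) (θ : ℝ) (q : ℝ≥0∞) (v : ℝ → ℝ) :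
    FunctionalSpace V where
  carrier := {f | f ∈ range (sumIncl i₀ i₁) ∧ weightedNorm θ q v (peetreK i₀ i₁ f) < ∞}
  functional f := weightedNorm θ q v (peetreK i₀ i₁ f)

/-- The functional `‖f‖_{θ,q,v;J} = inf ‖t ^ (-θ - 1/q) v(t) J(u(t), t; X₀, X₁)‖_{q, (0, ∞)}`, the
infimum extending over all representations `f = ∫_0^∞ u(s) ds/s`. It is `∞` if there are none. -/
def jNorm (i₀ : X₀ →L[𝕜] V) (i₁ : X₁ →L[𝕜] V) (θ : ℝ) (q : ℝ≥0∞) (v : ℝ → ℝ) (f : V) : ℝ≥0∞ :=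
  ⨅ (u : ℝ → InterSpace i₀ i₁) (_ : IsRepresentation i₀ i₁ f u),
    weightedNorm θ q v (fun t => peetreJ i₀ i₁ (u t) t)

/-- The space `(X₀, X₁)_{θ,q,v;J}` of all `f` which have a representation `f = ∫_0^∞ u(s) ds/s`
(with convergence in `X₀ + X₁`) and for which `‖f‖_{θ,q,v;J}` is finite. -/
def jSpace (i₀ : X₀ →L[𝕜] V) (i₁ : X₁ →L[𝕜] V) (θ : ℝ) (q : ℝ≥0∞) (v : ℝ → ℝ) :
    FunctionalSpace V where
  carrier := {f | (∃ u : ℝ → InterSpace i₀ i₁, IsRepresentation i₀ i₁ f u) ∧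
    jNorm i₀ i₁ θ q v f < ∞}
  functional := jNorm i₀ i₁ θ q v

end Spaces

end LimitingInterpolation

end

noncomputable section

set_option linter.unusedSectionVars false

namespace LimitingInterpolation

/-! ### Embeddings into the sum and the intersection of a couple -/

section Couple

variable {𝕜 : Type*} [RCLike 𝕜]
  {V : Type*} [AddCommGroup V] [Module 𝕜 V] [TopologicalSpace V] [IsTopologicalAddGroup V]
  [ContinuousSMul 𝕜 V] [T2Space V]
  {X₀ : Type*} [NormedAddCommGroup X₀] [NormedSpace 𝕜 X₀]
  {X₁ : Type*} [NormedAddCommGroup X₁] [NormedSpace 𝕜 X₁]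

/-! The three norms are compared in a cycle. Let N₁, N₂ be the J-norms with weights a and A, and N₃
the K-norm with weight B. It is shown that N₂ ≤ D₁ N₁, N₃ ≤ D₂ N₂ and N₁ ≤ 32 N₃, the last one on X₀
+ (X₀ ∩ X₁) = X₀. Finiteness and equivalence then pass around the cycle.

N₂ ≤ D₁ N₁ (`jNorm_interIncl_le`). On (0,1] the representing function u is kept, because there the
J-functional of (X₀, X₀ ∩ X₁) does not exceed that of (X₀, X₁). On (1,∞) the functional J(u(t), t)
dominates the norm of X₀ ∩ X₁. Since a is bounded below by a(∞) > 0, the integral g of u over (1,∞)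
with respect to ds/s converges in X₀ ∩ X₁. Spreading g over (1,2] makes the values of the weight
beyond 2 irrelevant, so a may be replaced by A there.

N₃ ≤ D₂ N₂ (`weightedNorm_peetreK_le_weightedNorm_peetreJ`). Splitting f = ∫ u(s) ds/s at s = t
gives K(f,t) ≤ ∫ min(1, t/s) J(u(s),s) ds/s. By Fubini it remains to bound ∫ min(1, t/s) (-A'(t)) dt
by a multiple of A(s). This integral equals the average of A(rs) over r in (0,1), and slow variation
gives A(rs) ≤ C r^(-1/2) A(s) (`lintegral_neg_deriv_mul_min_le`).

N₁ ≤ 32 N₃ (`jNorm_le_weightedNorm_peetreK`). A discretisation adapted to the weight is used: y_k in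
(0,1] with a(y_k) = 2^k a(1). Near-optimal p_k in X₀ ∩ X₁ for K(x, y_k), with p_0 = 0, converge to x
in X₀, so x is the sum of w_k = p_{k+1} - p_k. Each w_k is spread over an interval just to the right
of y_{k+1}, which yields a representation of cost at most 16 Σ a(y_k) K(x, y_k). As K is
non-decreasing and -A' has mass A(y_k) on (y_{k+1}, y_k], this sum is at most 2 N₃. The first term
is paid for by the mass A(1) of -A' on (1,∞), which is why A is continued by a function tending to
0. -/

/-- The embedding of `X₀` into `X₀ + X₁`. -/
def inlSum (i₀ : X₀ →L[𝕜] V) (i₁ : X₁ →L[𝕜] V) : X₀ →L[𝕜] SumSpace i₀ i₁ :=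
  (sumMap i₀ i₁).ker.mkQL.comp
    ((WithLp.prodContinuousLinearEquiv 1 𝕜 X₀ X₁).symm.toContinuousLinearMap.comp
      (ContinuousLinearMap.inl 𝕜 X₀ X₁))

/-- The embedding of `X₁` into `X₀ + X₁`. -/
def inrSum (i₀ : X₀ →L[𝕜] V) (i₁ : X₁ →L[𝕜] V) : X₁ →L[𝕜] SumSpace i₀ i₁ :=
  (sumMap i₀ i₁).ker.mkQL.comp
    ((WithLp.prodContinuousLinearEquiv 1 𝕜 X₀ X₁).symm.toContinuousLinearMap.comp
      (ContinuousLinearMap.inr 𝕜 X₀ X₁))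

variable (i₀ : X₀ →L[𝕜] V) (i₁ : X₁ →L[𝕜] V)

theorem sumIncl_inlSum (x : X₀) : sumIncl i₀ i₁ (inlSum i₀ i₁ x) = i₀ x := by
  change sumMap i₀ i₁ (WithLp.toLp 1 (x, 0)) = i₀ x
  simp [sumMap]

theorem sumIncl_inrSum (x : X₁) : sumIncl i₀ i₁ (inrSum i₀ i₁ x) = i₁ x := by
  change sumMap i₀ i₁ (WithLp.toLp 1 (0, x)) = i₁ x
  simp [sumMap]

theorem sumIncl_injective : Function.Injective (sumIncl i₀ i₁) := by
  rw [← LinearMap.ker_eq_bot]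
  exact Submodule.ker_liftQ_eq_bot _ _ _ le_rfl

theorem enorm_inlSum_le (x : X₀) : ‖inlSum i₀ i₁ x‖ₑ ≤ ‖x‖ₑ := by
  rw [enorm_le_iff_norm_le]
  refine (Submodule.Quotient.norm_mk_le (sumMap i₀ i₁).ker (WithLp.toLp 1 (x, (0 : X₁)))).trans ?_
  simp

theorem interToSum_eq_inlSum (y : InterSpace i₀ i₁) :
    interToSum i₀ i₁ y = inlSum i₀ i₁ y.1.1 := rfl

theorem InterSpace.incl_eq (y : InterSpace i₀ i₁) : i₀ y.1.1 = i₁ y.1.2 := y.2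

/-- The pairs (y, 0) and (0, y) have the same image in V and `sumIncl` is injective. This allows
part of an integral in X₀ + X₁ to be computed in X₁. -/
theorem interToSum_eq_inrSum (y : InterSpace i₀ i₁) :
    interToSum i₀ i₁ y = inrSum i₀ i₁ y.1.2 := by
  apply sumIncl_injective
  rw [interToSum_eq_inlSum, sumIncl_inlSum, sumIncl_inrSum, InterSpace.incl_eq]

theorem interIncl_apply (y : InterSpace i₀ i₁) : interIncl i₀ i₁ y = i₀ y.1.1 := rfl

theorem InterSpace.enorm_eq (y : InterSpace i₀ i₁) : ‖y‖ₑ = max ‖y.1.1‖ₑ ‖y.1.2‖ₑ := by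
  have : ‖y‖ = max ‖y.1.1‖ ‖y.1.2‖ := rfl
  rw [← ofReal_norm, this, ENNReal.ofReal_max, ofReal_norm, ofReal_norm]

instance InterSpace.completeSpace [CompleteSpace X₀] [CompleteSpace X₁] :
    CompleteSpace (InterSpace i₀ i₁) := by
  have : IsClosed (interSubmodule i₀ i₁ : Set (X₀ × X₁)) :=
    isClosed_eq (i₀.continuous.comp continuous_fst) (i₁.continuous.comp continuous_snd)
  exact this.completeSpace_coe

instance SumSpace.completeSpace [CompleteSpace X₀] [CompleteSpace X₁] :
    CompleteSpace (SumSpace i₀ i₁) := by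
  infer_instance

/-- The embedding of `X₀ ∩ X₁` into the intersection of the couple `(X₀, X₀ ∩ X₁)`. -/
def interDiag : InterSpace i₀ i₁ →L[𝕜] InterSpace i₀ (interIncl i₀ i₁) where
  toFun y := ⟨(y.1.1, y), rfl⟩
  map_add' _ _ := rfl
  map_smul' _ _ := rfl
  cont := by fun_prop

/-- An additive continuous map between real normed spaces commutes with Bochner integrals. -/
theorem integral_map_comp {E F : Type*} [NormedAddCommGroup E] [NormedSpace ℝ E]
    [NormedAddCommGroup F] [NormedSpace ℝ F] [CompleteSpace E] [CompleteSpace F]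
    (T : E →+ F) (hT : Continuous T) {s : Set ℝ} {u : ℝ → E}
    (hu : IntegrableOn (fun s : ℝ => s⁻¹ • u s) s volume) :
    IntegrableOn (fun s : ℝ => s⁻¹ • T (u s)) s volume ∧
      ∫ r in s, r⁻¹ • T (u r) = T (∫ r in s, r⁻¹ • u r) := by
  have h : ∀ r : ℝ, r⁻¹ • T (u r) = T.toRealLinearMap hT (r⁻¹ • u r) := fun r => by
    simp
  simp only [h]
  exact ⟨(T.toRealLinearMap hT).integrable_comp hu,
    (T.toRealLinearMap hT).integral_comp_comm hu⟩

theorem peetreK_le {f : V} {t : ℝ} (x : X₀) (y : X₁) (h : i₀ x + i₁ y = f) :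
    peetreK i₀ i₁ f t ≤ ‖x‖ₑ + ENNReal.ofReal t * ‖y‖ₑ :=
  iInf₂_le (x, y) h

theorem peetreK_mono (f : V) : Monotone (peetreK i₀ i₁ f) := by
  intro s t h
  unfold peetreK
  gcongr

theorem aemeasurable_peetreJ {μ : Measure ℝ} {u : ℝ → InterSpace i₀ i₁}
    (hu : AEStronglyMeasurable u μ) : AEMeasurable (fun t => peetreJ i₀ i₁ (u t) t) μ := by
  have h0 : AEStronglyMeasurable (fun t => (u t).1.1) μ :=
    (by fun_prop : Continuous fun y : InterSpace i₀ i₁ => y.1.1).comp_aestronglyMeasurable hu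
  have h1 : AEStronglyMeasurable (fun t => (u t).1.2) μ :=
    (by fun_prop : Continuous fun y : InterSpace i₀ i₁ => y.1.2).comp_aestronglyMeasurable hu
  exact h0.enorm.max ((by fun_prop : Measurable ENNReal.ofReal).aemeasurable.mul h1.enorm)

theorem weightedNorm_zero_one (v : ℝ → ℝ) (F : ℝ → ℝ≥0∞) :
    weightedNorm 0 1 v F = ∫⁻ t in Ioi (0 : ℝ), ENNReal.ofReal (t⁻¹ * v t) * F t := by
  simp [weightedNorm, eLpNorm_one_eq_lintegral_enorm, Real.rpow_neg_one]

end Couple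


/-! ### The measure -A'(t) dt and the Hardy-type kernel estimate -/

theorem deriv_nonpos_of_antitoneOn_Ioi {A : ℝ → ℝ} (hA : AntitoneOn A (Ioi 0)) {t : ℝ}
    (ht : 0 < t) : deriv A t ≤ 0 := by
  rw [← derivWithin_of_isOpen isOpen_Ioi (mem_Ioi.2 ht)]
  exact hA.derivWithin_nonpos

/-- The fundamental theorem of calculus for absolutely continuous functions. Later estimates use A'
only through the masses of intervals under -A'(t) dt. -/
theorem lintegral_neg_deriv_Ioc {A : ℝ → ℝ} (hA : AntitoneOn A (Ioi 0)) (hac : AbsContOnPos A)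
    {x y : ℝ} (hx : 0 < x) (hxy : x ≤ y) :
    ∫⁻ t in Ioc x y, ENNReal.ofReal (-deriv A t) = ENNReal.ofReal (A x - A y) := by
  have hi := (hac x y hx hxy).intervalIntegrable_deriv
  have hint := (hac x y hx hxy).integral_deriv_eq_sub
  rw [intervalIntegrable_iff_integrableOn_Ioc_of_le hxy] at hi
  rw [intervalIntegral.integral_of_le hxy] at hint
  have hi' : IntegrableOn (fun t => -deriv A t) (Ioc x y) := hi.neg
  rw [← ofReal_integral_eq_lintegral_ofReal hi', integral_neg, hint, neg_sub]
  filter_upwards [ae_restrict_mem measurableSet_Ioc] with t ht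
  exact neg_nonneg.2 (deriv_nonpos_of_antitoneOn_Ioi hA (hx.trans ht.1))

theorem lintegral_neg_deriv_Ioi {A : ℝ → ℝ} (hA : AntitoneOn A (Ioi 0)) (hac : AbsContOnPos A)
    (hlim : Tendsto A atTop (𝓝 0)) {x : ℝ} (hx : 0 < x) :
    ∫⁻ t in Ioi x, ENNReal.ofReal (-deriv A t) = ENNReal.ofReal (A x) := by
  have h1 : Tendsto (fun y : ℝ => ∫⁻ t in Ioc x y, ENNReal.ofReal (-deriv A t)) atTop
      (𝓝 (∫⁻ t in Ioi x, ENNReal.ofReal (-deriv A t))) := by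
    have := (aecover_Iic (μ := volume.restrict (Ioi x)) tendsto_id).lintegral_tendsto_of_countably_generated
      (f := fun t => ENNReal.ofReal (-deriv A t))
      ((measurable_deriv A).neg.ennreal_ofReal.aemeasurable)
    refine this.congr fun y => ?_
    rw [Measure.restrict_restrict measurableSet_Iic, inter_comm, Ioi_inter_Iic, id]
  have h2 : Tendsto (fun y : ℝ => ENNReal.ofReal (A x - A y)) atTop
      (𝓝 (ENNReal.ofReal (A x - 0))) :=
    (ENNReal.continuous_ofReal.tendsto _).comp (tendsto_const_nhds.sub hlim)
  rw [sub_zero] at h2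
  refine tendsto_nhds_unique h1 (h2.congr' ?_)
  filter_upwards [eventually_ge_atTop x] with y hy
  exact (lintegral_neg_deriv_Ioc hA hac hx hy).symm

/-- A slowly varying function is, up to a constant, increasing after multiplication by a positive
power. -/
theorem SlowlyVarying.exists_rpow_mul_le {b : ℝ → ℝ} (hb : SlowlyVarying b) {ε : ℝ} (hε : 0 < ε) :
    ∃ C : ℝ, 0 < C ∧ ∀ x y : ℝ, 0 < x → x ≤ y → x ^ ε * b x ≤ C * (y ^ ε * b y) := by
  obtain ⟨φ, hφ, c, C, hc, hC, h⟩ := hb.equiv_monotone ε hε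
  refine ⟨C / c, by positivity, fun x y hx hxy => ?_⟩
  have hy := hx.trans_le hxy
  calc x ^ ε * b x ≤ C * φ x := (h x hx).2
    _ ≤ C * φ y := by gcongr; exact hφ hx hy hxy
    _ = C / c * (c * φ y) := by field_simp
    _ ≤ C / c * (y ^ ε * b y) :=
      mul_le_mul_of_nonneg_left (h y hy).1 (by positivity)

/-- The kernel estimate behind the Hardy-type inequality for `-A'`. -/
theorem lintegral_neg_deriv_mul_min_le {A : ℝ → ℝ} (hA : AntitoneOn A (Ioi 0))
    (hac : AbsContOnPos A) (hlim : Tendsto A atTop (𝓝 0)) {C : ℝ} (hC : 0 < C)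
    (hpos : ∀ t, 0 < t → 0 < A t)
    (h : ∀ x y : ℝ, 0 < x → x ≤ y → x ^ (1 / 2 : ℝ) * A x ≤ C * (y ^ (1 / 2 : ℝ) * A y))
    {s : ℝ} (hs : 0 < s) :
    ∫⁻ t in Ioi (0 : ℝ), ENNReal.ofReal (-deriv A t) * ENNReal.ofReal (min 1 (t / s)) ≤
      ENNReal.ofReal (2 * C * A s) := by
  have hg : Measurable fun t => ENNReal.ofReal (-deriv A t) :=
    (measurable_deriv A).neg.ennreal_ofReal
  have hm : MeasurableSet {p : ℝ × ℝ | p.2 * s < p.1} :=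
    measurableSet_lt (by fun_prop) (by fun_prop)
  -- Layer-cake form of the kernel: min(1, t/s) is the length of the set of r in (0,1] with rs < t.
  -- After Tonelli the inner integral over t > rs is A(rs).
  have key : ∀ t ∈ Ioi (0 : ℝ), ENNReal.ofReal (min 1 (t / s)) =
      ∫⁻ r in Ioc (0 : ℝ) 1, {p : ℝ × ℝ | p.2 * s < p.1}.indicator (fun _ => (1 : ℝ≥0∞)) (t, r) := by
    intro t ht
    have h1 : ∀ r : ℝ, {p : ℝ × ℝ | p.2 * s < p.1}.indicator (fun _ => (1 : ℝ≥0∞)) (t, r) =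
        (Iio (t / s)).indicator (fun _ => (1 : ℝ≥0∞)) r := by
      intro r
      simp only [indicator, mem_ofPred_eq, mem_Iio, lt_div_iff₀ hs]
    simp only [h1]
    rw [lintegral_indicator_const measurableSet_Iio, one_mul,
      Measure.restrict_apply measurableSet_Iio]
    apply le_antisymm
    · calc _ = volume (Ioo (0 : ℝ) (min 1 (t / s))) := by simp
        _ ≤ volume (Iio (t / s) ∩ Ioc 0 1) := measure_mono fun r hr =>
          ⟨hr.2.trans_le (min_le_right _ _), hr.1, (hr.2.trans_le (min_le_left _ _)).le⟩
    · calc _ ≤ volume (Icc (0 : ℝ) (min 1 (t / s))) :=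
          measure_mono fun r hr => ⟨hr.2.1.le, le_min hr.2.2 (le_of_lt hr.1)⟩
        _ = _ := by simp
  calc ∫⁻ t in Ioi (0 : ℝ), ENNReal.ofReal (-deriv A t) * ENNReal.ofReal (min 1 (t / s))
      = ∫⁻ t in Ioi (0 : ℝ), ∫⁻ r in Ioc (0 : ℝ) 1, ENNReal.ofReal (-deriv A t) *
          {p : ℝ × ℝ | p.2 * s < p.1}.indicator (fun _ => (1 : ℝ≥0∞)) (t, r) := by
        refine setLIntegral_congr_fun measurableSet_Ioi fun t ht => ?_
        rw [key t ht, lintegral_const_mul]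
        exact (measurable_const.indicator hm).comp (by fun_prop)
    _ = ∫⁻ r in Ioc (0 : ℝ) 1, ∫⁻ t in Ioi (0 : ℝ), ENNReal.ofReal (-deriv A t) *
          {p : ℝ × ℝ | p.2 * s < p.1}.indicator (fun _ => (1 : ℝ≥0∞)) (t, r) := by
        refine lintegral_lintegral_swap (Measurable.aemeasurable ?_)
        exact (hg.comp measurable_fst).mul (measurable_const.indicator hm)
    _ ≤ ∫⁻ r in Ioc (0 : ℝ) 1, ENNReal.ofReal (C * A s * r ^ (-1 / 2 : ℝ)) := by
        refine setLIntegral_mono (by fun_prop) fun r hr => ?_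
        have hr0 : 0 < r := hr.1
        have hrs : 0 < r * s := mul_pos hr0 hs
        have h1 : ∀ t : ℝ, ENNReal.ofReal (-deriv A t) *
            {p : ℝ × ℝ | p.2 * s < p.1}.indicator (fun _ => (1 : ℝ≥0∞)) (t, r) =
            (Ioi (r * s)).indicator (fun t => ENNReal.ofReal (-deriv A t)) t := by
          intro t
          by_cases ht : r * s < t <;> simp [indicator, ht]
        simp only [h1]
        rw [lintegral_indicator measurableSet_Ioi, Measure.restrict_restrict measurableSet_Ioi,
          inter_eq_left.2 (Ioi_subset_Ioi hrs.le), lintegral_neg_deriv_Ioi hA hac hlim hrs]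
        apply ENNReal.ofReal_le_ofReal
        -- Slow variation with ε = 1/2 gives A(rs) ≤ C r^(-1/2) A(s). The power is integrable at 0,
        -- and its integral over (0,1] is the factor 2 of the claim.
        have h2 := h (r * s) s hrs (by nlinarith [hr.2])
        rw [Real.mul_rpow hr0.le hs.le] at h2
        have h3 : r ^ (1 / 2 : ℝ) * A (r * s) ≤ C * A s := by
          have : 0 < s ^ (1 / 2 : ℝ) := by positivity
          refine le_of_mul_le_mul_left ?_ this
          linarith
        rw [show (-1 / 2 : ℝ) = -(1 / 2) by norm_num, Real.rpow_neg hr0.le, ← div_eq_mul_inv,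
          le_div_iff₀ (by positivity)]
        linarith
    _ = ENNReal.ofReal (2 * C * A s) := by
        have hi : IntervalIntegrable (fun r : ℝ => r ^ (-1 / 2 : ℝ)) volume 0 1 :=
          intervalIntegral.intervalIntegrable_rpow' (by norm_num)
        rw [intervalIntegrable_iff_integrableOn_Ioc_of_le zero_le_one] at hi
        have := hpos s hs
        rw [← ofReal_integral_eq_lintegral_ofReal (hi.const_mul _), integral_const_mul,
          ← intervalIntegral.integral_of_le zero_le_one, integral_rpow (by norm_num)]
        · congr 1; norm_num; ring
        · filter_upwards [ae_restrict_mem measurableSet_Ioc] with r hr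
          have := hr.1
          positivity


/-! ### From J to K -/

section Couple

variable {𝕜 : Type*} [RCLike 𝕜]
  {V : Type*} [AddCommGroup V] [Module 𝕜 V] [TopologicalSpace V] [IsTopologicalAddGroup V]
  [ContinuousSMul 𝕜 V] [T2Space V]
  {X₀ : Type*} [NormedAddCommGroup X₀] [NormedSpace 𝕜 X₀] [CompleteSpace X₀]
  {X₁ : Type*} [NormedAddCommGroup X₁] [NormedSpace 𝕜 X₁] [CompleteSpace X₁]
  (i₀ : X₀ →L[𝕜] V) (i₁ : X₁ →L[𝕜] V)

theorem enorm_real_inv_smul {E : Type*} [NormedAddCommGroup E] [NormedSpace ℝ E] {s : ℝ}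
    (hs : 0 < s) (x : E) : ‖s⁻¹ • x‖ₑ = ENNReal.ofReal s⁻¹ * ‖x‖ₑ := by
  rw [enorm_smul, Real.enorm_of_nonneg (inv_nonneg.2 hs.le)]

/-- Membership in `L₁(ds/s)` on a subset of `(0, ∞)` in terms of the upper integral. -/
theorem integrableOn_inv_smul {E : Type*} [NormedAddCommGroup E] [NormedSpace ℝ E] {S : Set ℝ}
    (hS : MeasurableSet S) (hS0 : S ⊆ Ioi 0) {v : ℝ → E}
    (hv : AEStronglyMeasurable v (volume.restrict (Ioi (0 : ℝ))))
    (h : ∫⁻ s in S, ENNReal.ofReal s⁻¹ * ‖v s‖ₑ < ∞) :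
    IntegrableOn (fun s => s⁻¹ • v s) S := by
  refine ⟨((by fun_prop : Measurable fun s : ℝ => s⁻¹).aestronglyMeasurable).smul
    (hv.mono_measure (Measure.restrict_mono hS0 le_rfl)), ?_⟩
  rw [hasFiniteIntegral_iff_enorm]
  rwa [setLIntegral_congr_fun hS fun s hs => enorm_real_inv_smul (hS0 hs) (v s)]

theorem enorm_setIntegral_inv_smul_le {E : Type*} [NormedAddCommGroup E] [NormedSpace ℝ E]
    {S : Set ℝ} (hS : MeasurableSet S) (hS0 : S ⊆ Ioi 0) (v : ℝ → E) :
    ‖∫ s in S, s⁻¹ • v s‖ₑ ≤ ∫⁻ s in S, ENNReal.ofReal s⁻¹ * ‖v s‖ₑ := by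
  refine (enorm_integral_le_lintegral_enorm _).trans_eq ?_
  exact setLIntegral_congr_fun hS fun s hs => enorm_real_inv_smul (hS0 hs) (v s)

theorem aestronglyMeasurable_inter_components {μ : Measure ℝ} {u : ℝ → InterSpace i₀ i₁}
    (hu : AEStronglyMeasurable u μ) :
    AEStronglyMeasurable (fun t => (u t).1.1) μ ∧ AEStronglyMeasurable (fun t => (u t).1.2) μ :=
  ⟨(by fun_prop : Continuous fun y : InterSpace i₀ i₁ => y.1.1).comp_aestronglyMeasurable hu,
    (by fun_prop : Continuous fun y : InterSpace i₀ i₁ => y.1.2).comp_aestronglyMeasurable hu⟩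

/-- The `K`-functional of `f = ∫ u(s) ds/s` is controlled by the `J`-functionals of `u(s)`. -/
theorem peetreK_le_lintegral_peetreJ [NormedSpace ℝ X₀] [NormedSpace ℝ X₁] {f : V}
    {u : ℝ → InterSpace i₀ i₁} (hu : IsRepresentation i₀ i₁ f u) {t : ℝ} (ht : 0 < t) :
    peetreK i₀ i₁ f t ≤ ∫⁻ s in Ioi (0 : ℝ),
      ENNReal.ofReal (min 1 (t / s)) * (ENNReal.ofReal s⁻¹ * peetreJ i₀ i₁ (u s) s) := by
  set G : ℝ → ℝ≥0∞ := fun s =>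
    ENNReal.ofReal (min 1 (t / s)) * (ENNReal.ofReal s⁻¹ * peetreJ i₀ i₁ (u s) s) with hG
  have hsplit : ∫⁻ s in Ioi (0 : ℝ), G s = (∫⁻ s in Ioc 0 t, G s) + ∫⁻ s in Ioi t, G s := by
    rw [← Ioc_union_Ioi_eq_Ioi ht.le, lintegral_union measurableSet_Ioi (Ioc_disjoint_Ioi le_rfl)]
  rw [hsplit]
  have hsub0 : Ioc 0 t ⊆ Ioi (0 : ℝ) := fun s hs => hs.1
  have hsub1 : Ioi t ⊆ Ioi (0 : ℝ) := Ioi_subset_Ioi ht.le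
  obtain ⟨hm0, hm1⟩ := aestronglyMeasurable_inter_components i₀ i₁ hu.stronglyMeasurable
  have hle0 : ∫⁻ s in Ioc 0 t, ENNReal.ofReal s⁻¹ * ‖(u s).1.1‖ₑ ≤ ∫⁻ s in Ioc 0 t, G s := by
    refine lintegral_mono_ae ?_
    filter_upwards [ae_restrict_mem measurableSet_Ioc] with s hs
    simp only [hG, min_eq_left ((one_le_div hs.1).2 hs.2), ENNReal.ofReal_one, one_mul]
    gcongr
    exact le_max_left _ _
  have hle1 : ENNReal.ofReal t * ∫⁻ s in Ioi t, ENNReal.ofReal s⁻¹ * ‖(u s).1.2‖ₑ ≤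
      ∫⁻ s in Ioi t, G s := by
    rw [← lintegral_const_mul' _ _ ENNReal.ofReal_ne_top]
    refine lintegral_mono_ae ?_
    filter_upwards [ae_restrict_mem measurableSet_Ioi] with s hs
    have hs0 : 0 < s := ht.trans hs
    simp only [hG, min_eq_right ((div_le_one hs0).2 (le_of_lt hs))]
    calc ENNReal.ofReal t * (ENNReal.ofReal s⁻¹ * ‖(u s).1.2‖ₑ)
        = ENNReal.ofReal (t / s) * (ENNReal.ofReal s⁻¹ * (ENNReal.ofReal s * ‖(u s).1.2‖ₑ)) := by
          simp only [← mul_assoc, ← ENNReal.ofReal_mul ht.le, ← ENNReal.ofReal_mul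
            (div_pos ht hs0).le, ← ENNReal.ofReal_mul (mul_pos (div_pos ht hs0) (inv_pos.2 hs0)).le]
          congr 2
          field_simp
      _ ≤ _ := by gcongr; exact le_max_right _ _
  -- An infinite piece makes the bound trivial. Otherwise u is integrable in X₀ on (0,t] and in X₁
  -- on (t,∞), and the two integrals form an admissible decomposition of f.
  rcases eq_or_ne (∫⁻ s in Ioc 0 t, G s) ∞ with h0 | h0
  · simp [h0]
  rcases eq_or_ne (∫⁻ s in Ioi t, G s) ∞ with h1 | h1
  · simp [h1]
  have hi0 := integrableOn_inv_smul measurableSet_Ioc hsub0 hm0 (hle0.trans_lt h0.lt_top)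
  have hi1 := integrableOn_inv_smul measurableSet_Ioi hsub1 hm1 <| by
    refine ENNReal.lt_top_of_mul_ne_top_right (hle1.trans_lt h1.lt_top).ne ?_
    simpa using ht
  -- Only additivity and continuity are used, since the real structures on X₀ and X₁ are not assumed
  -- to be the restrictions of the 𝕜-structures.
  obtain ⟨-, e0⟩ := integral_map_comp (inlSum i₀ i₁ : X₀ →+ SumSpace i₀ i₁)
    (inlSum i₀ i₁).continuous hi0
  obtain ⟨-, e1⟩ := integral_map_comp (inrSum i₀ i₁ : X₁ →+ SumSpace i₀ i₁)
    (inrSum i₀ i₁).continuous hi1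
  have hf : i₀ (∫ s in Ioc 0 t, s⁻¹ • (u s).1.1) + i₁ (∫ s in Ioi t, s⁻¹ • (u s).1.2) = f := by
    rw [← sumIncl_inlSum i₀ i₁, ← sumIncl_inrSum i₀ i₁, ← map_add, ← hu.eq_integral,
      ← Ioc_union_Ioi_eq_Ioi ht.le, setIntegral_union (Ioc_disjoint_Ioi le_rfl) measurableSet_Ioi
        (hu.integrable.mono_set hsub0) (hu.integrable.mono_set hsub1)]
    congr 2
    · refine e0.symm.trans ?_
      rfl
    · refine e1.symm.trans ?_
      simp only [interToSum_eq_inrSum]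
      rfl
  refine (peetreK_le i₀ i₁ _ _ hf).trans (add_le_add ?_ ?_)
  · exact (enorm_setIntegral_inv_smul_le measurableSet_Ioc hsub0 _).trans hle0
  · refine le_trans ?_ hle1
    gcongr
    exact enorm_setIntegral_inv_smul_le measurableSet_Ioi hsub1 _

/-- The embedding of a limiting `J`-space into the `K`-space with weight `-t A'(t)`. -/
theorem weightedNorm_peetreK_le_weightedNorm_peetreJ [NormedSpace ℝ X₀] [NormedSpace ℝ X₁]
    {A B : ℝ → ℝ} (hB : ∀ᵐ x ∂(volume.restrict (Ioi (0 : ℝ))), B x = -x * deriv A x)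
    {C : ℝ} (hC : 0 ≤ C)
    (hA : ∀ s : ℝ, 0 < s →
      ∫⁻ t in Ioi (0 : ℝ), ENNReal.ofReal (-deriv A t) * ENNReal.ofReal (min 1 (t / s)) ≤
        ENNReal.ofReal (C * A s))
    {f : V} {u : ℝ → InterSpace i₀ i₁} (hu : IsRepresentation i₀ i₁ f u) :
    weightedNorm 0 1 B (peetreK i₀ i₁ f) ≤
      ENNReal.ofReal C * weightedNorm 0 1 A (fun t => peetreJ i₀ i₁ (u t) t) := by
  rw [weightedNorm_zero_one, weightedNorm_zero_one]
  have hg : Measurable fun t => ENNReal.ofReal (-deriv A t) :=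
    (measurable_deriv A).neg.ennreal_ofReal
  have hJ : AEMeasurable (fun s => ENNReal.ofReal s⁻¹ * peetreJ i₀ i₁ (u s) s)
      (volume.restrict (Ioi 0)) :=
    (by fun_prop : Measurable fun s : ℝ => ENNReal.ofReal s⁻¹).aemeasurable.mul
      (aemeasurable_peetreJ i₀ i₁ hu.stronglyMeasurable)
  have hk : Measurable fun p : ℝ × ℝ => ENNReal.ofReal (min 1 (p.1 / p.2)) := by fun_prop
  calc ∫⁻ t in Ioi (0 : ℝ), ENNReal.ofReal (t⁻¹ * B t) * peetreK i₀ i₁ f t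
      ≤ ∫⁻ t in Ioi (0 : ℝ), ∫⁻ s in Ioi (0 : ℝ), ENNReal.ofReal (-deriv A t) *
          (ENNReal.ofReal (min 1 (t / s)) *
            (ENNReal.ofReal s⁻¹ * peetreJ i₀ i₁ (u s) s)) := by
        refine lintegral_mono_ae ?_
        filter_upwards [hB, ae_restrict_mem measurableSet_Ioi] with t hBt ht
        have ht0 : t ≠ 0 := (mem_Ioi.1 ht).ne'
        rw [lintegral_const_mul' _ _ ENNReal.ofReal_ne_top, hBt,
          show t⁻¹ * (-t * deriv A t) = -deriv A t by field_simp]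
        gcongr
        exact peetreK_le_lintegral_peetreJ i₀ i₁ hu ht
    _ = ∫⁻ s in Ioi (0 : ℝ), ∫⁻ t in Ioi (0 : ℝ), ENNReal.ofReal (-deriv A t) *
          (ENNReal.ofReal (min 1 (t / s)) *
            (ENNReal.ofReal s⁻¹ * peetreJ i₀ i₁ (u s) s)) := by
        refine lintegral_lintegral_swap ?_
        exact (hg.comp measurable_fst).aemeasurable.mul (hk.aemeasurable.mul hJ.comp_snd)
    _ ≤ ∫⁻ s in Ioi (0 : ℝ), ENNReal.ofReal C *
          (ENNReal.ofReal (s⁻¹ * A s) * peetreJ i₀ i₁ (u s) s) := by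
        refine lintegral_mono_ae ?_
        filter_upwards [ae_restrict_mem measurableSet_Ioi] with s hs
        have hgm : Measurable fun t =>
            ENNReal.ofReal (-deriv A t) * ENNReal.ofReal (min 1 (t / s)) := hg.mul (by fun_prop)
        calc _ = (∫⁻ t in Ioi (0 : ℝ), ENNReal.ofReal (-deriv A t) *
              ENNReal.ofReal (min 1 (t / s))) *
              (ENNReal.ofReal s⁻¹ * peetreJ i₀ i₁ (u s) s) := by
              rw [← lintegral_mul_const _ hgm]
              simp only [mul_assoc]
          _ ≤ ENNReal.ofReal (C * A s) * (ENNReal.ofReal s⁻¹ * peetreJ i₀ i₁ (u s) s) := by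
              gcongr
              exact hA s hs
          _ = _ := by
              rw [ENNReal.ofReal_mul hC, ENNReal.ofReal_mul (inv_pos.2 hs).le]
              ring
    _ = _ := lintegral_const_mul' _ _ ENNReal.ofReal_ne_top

end Couple


/-! ### From the J-space of (X₀, X₁) to the J-space of (X₀, X₀ ∩ X₁) -/

section Couple

variable {𝕜 : Type*} [RCLike 𝕜]
  {V : Type*} [AddCommGroup V] [Module 𝕜 V] [TopologicalSpace V] [IsTopologicalAddGroup V]
  [ContinuousSMul 𝕜 V] [T2Space V]
  {X₀ : Type*} [NormedAddCommGroup X₀] [NormedSpace 𝕜 X₀] [CompleteSpace X₀]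
  {X₁ : Type*} [NormedAddCommGroup X₁] [NormedSpace 𝕜 X₁] [CompleteSpace X₁]
  (i₀ : X₀ →L[𝕜] V) (i₁ : X₁ →L[𝕜] V)

/-- Passing from X₁ to X₀ ∩ X₁ adds only the term t‖y‖ with the norm of X₀, which for t ≤ 1 is
absorbed by the first entry of the maximum. -/
theorem peetreJ_interDiag_le_of_le_one (y : InterSpace i₀ i₁) {t : ℝ} (ht : t ≤ 1) :
    peetreJ i₀ (interIncl i₀ i₁) (interDiag i₀ i₁ y) t ≤ peetreJ i₀ i₁ y t := by
  change max ‖y.1.1‖ₑ (ENNReal.ofReal t * ‖y‖ₑ) ≤ max ‖y.1.1‖ₑ (ENNReal.ofReal t * ‖y.1.2‖ₑ)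
  rw [InterSpace.enorm_eq, mul_max]
  refine max_le (le_max_left _ _) (max_le ?_ (le_max_right _ _))
  refine le_trans ?_ (le_max_left _ _)
  calc _ ≤ ENNReal.ofReal 1 * ‖y.1.1‖ₑ := by gcongr
    _ = _ := by simp

theorem enorm_le_peetreJ_of_one_le (y : InterSpace i₀ i₁) {t : ℝ} (ht : 1 ≤ t) :
    ‖y‖ₑ ≤ peetreJ i₀ i₁ y t := by
  rw [InterSpace.enorm_eq]
  refine max_le_max le_rfl ?_
  calc ‖y.1.2‖ₑ = ENNReal.ofReal 1 * ‖y.1.2‖ₑ := by simp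
    _ ≤ _ := by gcongr

theorem peetreJ_interDiag_le (y : InterSpace i₀ i₁) {t : ℝ} (ht : 1 ≤ t) :
    peetreJ i₀ (interIncl i₀ i₁) (interDiag i₀ i₁ y) t ≤ ENNReal.ofReal t * ‖y‖ₑ := by
  refine max_le ?_ le_rfl
  calc ‖y.1.1‖ₑ ≤ ‖y‖ₑ := by rw [InterSpace.enorm_eq]; exact le_max_left _ _
    _ = ENNReal.ofReal 1 * ‖y‖ₑ := by simp
    _ ≤ _ := by gcongr

theorem peetreJ_zero (t : ℝ) : peetreJ i₀ i₁ 0 t = 0 := by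
  simp [peetreJ]

/-- The map `X₀ ∩ X₁ → X₀`. -/
def interFst : InterSpace i₀ i₁ →L[𝕜] X₀ :=
  (ContinuousLinearMap.fst 𝕜 X₀ X₁).comp (interSubmodule i₀ i₁).subtypeL

theorem integral_inlSum [NormedSpace ℝ X₀] {S : Set ℝ} {x : ℝ → X₀}
    (hx : IntegrableOn (fun s => s⁻¹ • x s) S) :
    IntegrableOn (fun s => s⁻¹ • inlSum i₀ i₁ (x s)) S ∧
      ∫ s in S, s⁻¹ • inlSum i₀ i₁ (x s) = inlSum i₀ i₁ (∫ s in S, s⁻¹ • x s) :=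
  integral_map_comp (inlSum i₀ i₁ : X₀ →+ SumSpace i₀ i₁) (inlSum i₀ i₁).continuous hx

/-- Replacing the part of `u` on `(1, ∞)` by a constant element spread over `(1, 2]`. -/
theorem integral_map_collect {E F : Type*} [NormedAddCommGroup E] [NormedSpace ℝ E]
    [NormedAddCommGroup F] [NormedSpace ℝ F] [CompleteSpace F] (T : E →+ F) (hT : Continuous T)
    {u : ℝ → E} (hu : IntegrableOn (fun s : ℝ => s⁻¹ • T (u s)) (Ioc 0 1)) (g : E) :
    IntegrableOn (fun s : ℝ => s⁻¹ • T ((Ioc 0 1).indicator u s +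
      (Ioc 1 2).indicator (fun t => t • g) s)) (Ioi 0) ∧
    ∫ s in Ioi (0 : ℝ), s⁻¹ • T ((Ioc 0 1).indicator u s +
      (Ioc 1 2).indicator (fun t => t • g) s) = (∫ s in Ioc (0 : ℝ) 1, s⁻¹ • T (u s)) + T g := by
  have heq : ∀ s : ℝ, s⁻¹ • T ((Ioc 0 1).indicator u s +
        (Ioc 1 2).indicator (fun t => t • g) s) =
      (Ioc 0 1).indicator (fun s => s⁻¹ • T (u s)) s + (Ioc 1 2).indicator (fun _ => T g) s := by
    intro s
    rw [map_add, smul_add]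
    congr 1
    · by_cases hs : s ∈ Ioc (0 : ℝ) 1
      · simp only [indicator_of_mem hs]
      · simp only [indicator_of_notMem hs, map_zero, smul_zero]
    · by_cases hs : s ∈ Ioc (1 : ℝ) 2
      · have hs0 : s ≠ 0 := (zero_lt_one.trans hs.1).ne'
        simp only [indicator_of_mem hs]
        rw [map_real_smul T hT, smul_smul, inv_mul_cancel₀ hs0, one_smul]
      · simp only [indicator_of_notMem hs, map_zero, smul_zero]
  have hI0 : IntegrableOn ((Ioc 0 1).indicator fun s : ℝ => s⁻¹ • T (u s)) (Ioi 0) :=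
    ((integrable_indicator_iff measurableSet_Ioc).2 hu).integrableOn
  have hI1 : IntegrableOn ((Ioc (1 : ℝ) 2).indicator fun _ => T g) (Ioi 0) := by
    refine ((integrable_indicator_iff measurableSet_Ioc).2 ?_).integrableOn
    exact integrableOn_const (by simp)
  simp only [heq]
  refine ⟨hI0.add hI1, ?_⟩
  rw [integral_add hI0 hI1, setIntegral_indicator measurableSet_Ioc,
    setIntegral_indicator measurableSet_Ioc, inter_eq_right.2 Ioc_subset_Ioi_self,
    inter_eq_right.2 (Ioc_subset_Ioi_self.trans (Ioi_subset_Ioi zero_le_one)), setIntegral_const]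
  norm_num

/-- Given a map `d` of `X₀ ∩ X₁` into a smaller space `X₀ ∩ X₂`, the representation of
`f = ∫ u(s) ds/s` in the couple `(X₀, X₂)` in which the part of `u` on `(1, ∞)` has been replaced
by its integral, spread over `(1, 2]`. -/
theorem IsRepresentation.collect_Ioi_one [NormedSpace ℝ X₀] [NormedSpace ℝ (InterSpace i₀ i₁)]
    {X₂ : Type*} [NormedAddCommGroup X₂] [NormedSpace 𝕜 X₂] [CompleteSpace X₂] (i₂ : X₂ →L[𝕜] V)
    {d : InterSpace i₀ i₁ → InterSpace i₀ i₂} (hd : Continuous d) (hd₁ : ∀ y, (d y).1.1 = y.1.1)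
    {f : V} {u : ℝ → InterSpace i₀ i₁} (hu : IsRepresentation i₀ i₁ f u)
    (h0 : IntegrableOn (fun s => s⁻¹ • (u s).1.1) (Ioc 0 1))
    (h1 : IntegrableOn (fun s => s⁻¹ • u s) (Ioi 1)) :
    IsRepresentation i₀ i₂ f (fun t => d
      ((Ioc 0 1).indicator u t +
        (Ioc 1 2).indicator (fun t => t • ∫ s in Ioi 1, s⁻¹ • u s) t)) := by
  set g := ∫ s in Ioi 1, s⁻¹ • u s with hg
  obtain ⟨hi, ei⟩ := integral_map_collect (interFst i₀ i₁ : InterSpace i₀ i₁ →+ X₀)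
    (interFst i₀ i₁).continuous h0 g
  obtain ⟨hj, ej⟩ := integral_inlSum i₀ i₂ hi
  have e0 := (integral_inlSum i₀ i₁ h0).2
  have e1 : ∫ s in Ioi (1 : ℝ), s⁻¹ • interToSum i₀ i₁ (u s) = inlSum i₀ i₁ g.1.1 := by
    obtain ⟨h2, e2⟩ := integral_map_comp (interFst i₀ i₁ : InterSpace i₀ i₁ →+ X₀)
      (interFst i₀ i₁).continuous h1
    exact (integral_inlSum i₀ i₁ h2).2.trans (congrArg _ e2)
  have hd₂ : ∀ y, interToSum i₀ i₂ (d y) = inlSum i₀ i₂ (interFst i₀ i₁ y) := fun y => by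
    rw [interToSum_eq_inlSum, hd₁]; rfl
  refine ⟨?_, ?_, ?_⟩
  · refine hd.comp_aestronglyMeasurable (AEStronglyMeasurable.add ?_ ?_)
    · exact hu.stronglyMeasurable.indicator measurableSet_Ioc
    · exact (aestronglyMeasurable_id.smul aestronglyMeasurable_const).indicator measurableSet_Ioc
  · simp only [hd₂]
    exact hj
  · simp only [hd₂]
    refine (congrArg _ (ej.trans (congrArg _ ei))).trans ?_
    rw [sumIncl_inlSum, map_add, ← hu.eq_integral, ← Ioc_union_Ioi_eq_Ioi zero_le_one,
      setIntegral_union (Ioc_disjoint_Ioi le_rfl) measurableSet_Ioi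
        (hu.integrable.mono_set Ioc_subset_Ioi_self)
        (hu.integrable.mono_set (Ioi_subset_Ioi zero_le_one)), map_add]
    congr 1
    · exact ((congrArg _ e0).trans (sumIncl_inlSum i₀ i₁ _)).symm
    · rw [e1, sumIncl_inlSum]
      rfl

/-- The embedding of `(X₀, X₁)_{0,1,a;J}` into `(X₀, X₀ ∩ X₁)_{0,1,A;J}`. -/
theorem jNorm_interIncl_le {a A : ℝ → ℝ} {L : ℝ} (hL : 0 < L) (haL : ∀ t, 0 < t → L ≤ a t)
    (hAa : ∀ t, 0 < t → t ≤ 1 → A t = a t) (hA : ∀ t, 1 ≤ t → A t ≤ a 1) {f : V}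
    {u : ℝ → InterSpace i₀ i₁} (hu : IsRepresentation i₀ i₁ f u) :
    jNorm i₀ (interIncl i₀ i₁) 0 1 A f ≤
      ENNReal.ofReal (1 + 2 * a 1 / L) * weightedNorm 0 1 a (fun t => peetreJ i₀ i₁ (u t) t) := by
  let : NormedSpace ℝ X₀ := NormedSpace.restrictScalars ℝ 𝕜 X₀
  let : NormedSpace ℝ (InterSpace i₀ i₁) := NormedSpace.restrictScalars ℝ 𝕜 _
  have ha1 : 0 < a 1 := hL.trans_le (haL 1 one_pos)
  set M := weightedNorm 0 1 a (fun t => peetreJ i₀ i₁ (u t) t) with hM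
  rw [weightedNorm_zero_one] at hM
  set M0 := ∫⁻ t in Ioc (0 : ℝ) 1, ENNReal.ofReal (t⁻¹ * a t) * peetreJ i₀ i₁ (u t) t with hM0
  set M1 := ∫⁻ t in Ioi (1 : ℝ), ENNReal.ofReal (t⁻¹ * a t) * peetreJ i₀ i₁ (u t) t with hM1
  have hsplit : M = M0 + M1 := by
    rw [hM, ← Ioc_union_Ioi_eq_Ioi zero_le_one,
      lintegral_union measurableSet_Ioi (Ioc_disjoint_Ioi le_rfl)]
  rcases eq_or_ne M ∞ with htop | htop
  · rw [htop, ENNReal.mul_top (by simp; positivity)]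
    exact le_top
  have hM0t : M0 ≠ ∞ := (le_self_add.trans_lt (hsplit ▸ htop.lt_top)).ne
  have hM1t : M1 ≠ ∞ := (le_add_self.trans_lt (hsplit ▸ htop.lt_top)).ne
  have hle : ∀ t : ℝ, 0 < t → ENNReal.ofReal t⁻¹ ≤
      ENNReal.ofReal L⁻¹ * ENNReal.ofReal (t⁻¹ * a t) := by
    intro t ht
    rw [← ENNReal.ofReal_mul (by positivity)]
    apply ENNReal.ofReal_le_ofReal
    rw [inv_mul_eq_div, le_div_iff₀ hL]
    exact mul_le_mul_of_nonneg_left (haL t ht) (by positivity)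
  have hle0 : ∫⁻ s in Ioc (0 : ℝ) 1, ENNReal.ofReal s⁻¹ * ‖(u s).1.1‖ₑ ≤
      ENNReal.ofReal L⁻¹ * M0 := by
    rw [hM0, ← lintegral_const_mul' _ _ ENNReal.ofReal_ne_top]
    refine lintegral_mono_ae ?_
    filter_upwards [ae_restrict_mem measurableSet_Ioc] with s hs
    rw [← mul_assoc]
    exact mul_le_mul' (hle s hs.1) (le_max_left _ _)
  -- The lower bound L for a makes the tail of u absolutely integrable in X₀ ∩ X₁ and not merely in
  -- X₀ + X₁.
  have hle1 : ∫⁻ s in Ioi (1 : ℝ), ENNReal.ofReal s⁻¹ * ‖u s‖ₑ ≤ ENNReal.ofReal L⁻¹ * M1 := by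
    rw [hM1, ← lintegral_const_mul' _ _ ENNReal.ofReal_ne_top]
    refine lintegral_mono_ae ?_
    filter_upwards [ae_restrict_mem measurableSet_Ioi] with s hs
    rw [← mul_assoc]
    exact mul_le_mul' (hle s (zero_lt_one.trans hs)) (enorm_le_peetreJ_of_one_le i₀ i₁ _ (le_of_lt hs))
  have hsub : Ioi (1 : ℝ) ⊆ Ioi 0 := Ioi_subset_Ioi zero_le_one
  have hi0 := integrableOn_inv_smul measurableSet_Ioc Ioc_subset_Ioi_self
    (aestronglyMeasurable_inter_components i₀ i₁ hu.stronglyMeasurable).1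
    (hle0.trans_lt (ENNReal.mul_lt_top ENNReal.ofReal_lt_top hM0t.lt_top))
  have hi1 := integrableOn_inv_smul measurableSet_Ioi hsub hu.stronglyMeasurable
    (hle1.trans_lt (ENNReal.mul_lt_top ENNReal.ofReal_lt_top hM1t.lt_top))
  have hg := (enorm_setIntegral_inv_smul_le measurableSet_Ioi hsub u).trans hle1
  have hrep := IsRepresentation.collect_Ioi_one i₀ i₁ (interIncl i₀ i₁)
    (interDiag i₀ i₁).continuous (fun _ => rfl) hu hi0 hi1
  set g := ∫ s in Ioi (1 : ℝ), s⁻¹ • u s with hgdef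
  refine (iInf₂_le _ hrep).trans ?_
  rw [weightedNorm_zero_one, ← Ioc_union_Ioi_eq_Ioi zero_le_one,
    lintegral_union measurableSet_Ioi (Ioc_disjoint_Ioi le_rfl)]
  have hA0 : ∫⁻ t in Ioc (0 : ℝ) 1, ENNReal.ofReal (t⁻¹ * A t) *
      peetreJ i₀ (interIncl i₀ i₁) (interDiag i₀ i₁ ((Ioc 0 1).indicator u t +
        (Ioc 1 2).indicator (fun t => t • g) t)) t ≤ M0 := by
    refine lintegral_mono_ae ?_
    filter_upwards [ae_restrict_mem measurableSet_Ioc] with t ht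
    rw [indicator_of_mem ht, indicator_of_notMem (fun h => (h.1.trans_le ht.2).false), add_zero,
      hAa t ht.1 ht.2]
    gcongr
    exact peetreJ_interDiag_le_of_le_one i₀ i₁ _ ht.2
  have hA1 : ∫⁻ t in Ioi (1 : ℝ), ENNReal.ofReal (t⁻¹ * A t) *
      peetreJ i₀ (interIncl i₀ i₁) (interDiag i₀ i₁ ((Ioc 0 1).indicator u t +
        (Ioc 1 2).indicator (fun t => t • g) t)) t ≤
      ENNReal.ofReal (2 * a 1) * ‖g‖ₑ := by
    -- On (1,2] the integrand is at most t⁻¹ · a(1) · t · ‖t g‖ ≤ 2 a(1) ‖g‖, and the interval has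
    -- length 1.
    calc _ ≤ ∫⁻ t in Ioi (1 : ℝ), (Ioc (1 : ℝ) 2).indicator
          (fun _ => ENNReal.ofReal (2 * a 1) * ‖g‖ₑ) t := by
          refine lintegral_mono_ae ?_
          filter_upwards [ae_restrict_mem measurableSet_Ioi] with t ht
          rw [indicator_of_notMem (fun h : t ∈ Ioc (0 : ℝ) 1 => h.2.not_gt ht), zero_add]
          by_cases h2 : t ∈ Ioc (1 : ℝ) 2
          · rw [indicator_of_mem h2, indicator_of_mem h2]
            have ht0 : 0 < t := zero_lt_one.trans ht
            calc _ ≤ ENNReal.ofReal (t⁻¹ * a 1) * (ENNReal.ofReal t * ‖t • g‖ₑ) := by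
                  gcongr
                  · exact hA t (le_of_lt ht)
                  · exact peetreJ_interDiag_le i₀ i₁ _ (le_of_lt ht)
              _ = ENNReal.ofReal (t * a 1) * ‖g‖ₑ := by
                  rw [enorm_smul, Real.enorm_of_nonneg ht0.le, ← mul_assoc, ← mul_assoc,
                    ← ENNReal.ofReal_mul (by positivity), ← ENNReal.ofReal_mul (by positivity)]
                  congr 2
                  field_simp
              _ ≤ _ := by
                  gcongr
                  exact h2.2
          · rw [indicator_of_notMem h2, indicator_of_notMem h2, map_zero, peetreJ_zero, mul_zero]
      _ = _ := by
          rw [lintegral_indicator_const measurableSet_Ioc,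
            Measure.restrict_apply measurableSet_Ioc, inter_eq_left.2 Ioc_subset_Ioi_self]
          norm_num
  have hnn : 0 ≤ 2 * a 1 / L := by positivity
  calc _ ≤ M0 + ENNReal.ofReal (2 * a 1) * (ENNReal.ofReal L⁻¹ * M1) :=
        add_le_add hA0 (hA1.trans (by gcongr))
    _ = M0 + ENNReal.ofReal (2 * a 1 / L) * M1 := by
        rw [← mul_assoc, ← ENNReal.ofReal_mul (by positivity), ← div_eq_mul_inv]
    _ ≤ M + ENNReal.ofReal (2 * a 1 / L) * M := by
        gcongr
        · exact hsplit ▸ le_self_add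
        · exact hsplit ▸ le_add_self
    _ = _ := by rw [ENNReal.ofReal_add zero_le_one hnn, ENNReal.ofReal_one, add_mul, one_mul]

end Couple


/-! ### Dyadic level points of the weight and step functions -/

/-- A strictly decreasing continuous function which blows up at `0` takes the values `2 ^ k a(1)`
at points of `(0, 1]` decreasing to `0`. -/
theorem exists_dyadic_level_points {a : ℝ → ℝ} (ha : StrictAntiOn a (Ioi 0))
    (hcont : ContinuousOn a (Ioi 0)) (hlim : Tendsto a (𝓝[>] 0) atTop) (h1 : 0 < a 1) :
    ∃ y : ℕ → ℝ, y 0 = 1 ∧ StrictAnti y ∧ (∀ k, 0 < y k) ∧ (∀ k, a (y k) = 2 ^ k * a 1) ∧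
      Tendsto y atTop (𝓝 0) := by
  have hex : ∀ k : ℕ, ∃ t : ℝ, 0 < t ∧ a t = 2 ^ k * a 1 := by
    intro k
    have hev := (hlim.eventually_ge_atTop (2 ^ k * a 1)).and
      (Ioo_mem_nhdsGT (zero_lt_one' ℝ))
    obtain ⟨s, hs, hs0, hs1⟩ := hev.exists
    have hle : a 1 ≤ 2 ^ k * a 1 := le_mul_of_one_le_left h1.le (one_le_pow₀ one_le_two)
    obtain ⟨t, ht, hta⟩ := intermediate_value_Icc' hs1.le
      (hcont.mono fun x hx => hs0.trans_le hx.1) ⟨hle, hs⟩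
    exact ⟨t, hs0.trans_le ht.1, hta⟩
  choose y hy0 hy using hex
  have hanti : StrictAnti y := strictAnti_nat_of_succ_lt fun k => by
    rw [← ha.lt_iff_gt (hy0 k) (hy0 (k + 1)), hy, hy, pow_succ]
    have : 0 < 2 ^ k * a 1 := by positivity
    linarith
  refine ⟨y, ?_, hanti, hy0, hy, ?_⟩
  · refine ha.injOn (hy0 0) (mem_Ioi.2 one_pos) ?_
    simp [hy]
  · refine tendsto_order.2 ⟨fun b hb => .of_forall fun k => hb.trans (hy0 k), fun b hb => ?_⟩
    have hpow : Tendsto (fun k : ℕ => (2 : ℝ) ^ k * a 1) atTop atTop :=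
      (tendsto_pow_atTop_atTop_of_one_lt one_lt_two).atTop_mul_const h1
    filter_upwards [hpow.eventually_gt_atTop (a b)] with k hk
    rwa [← hy, ha.lt_iff_gt (mem_Ioi.2 hb) (hy0 k)] at hk

theorem iUnion_Ioc_succ_eq {y : ℕ → ℝ} (hy : Antitone y) (hpos : ∀ k, 0 < y k)
    (hlim : Tendsto y atTop (𝓝 0)) : ⋃ k, Ioc (y (k + 1)) (y k) = Ioc 0 (y 0) := by
  ext t
  simp only [mem_iUnion, mem_Ioc]
  constructor
  · rintro ⟨k, h1, h2⟩
    exact ⟨(hpos _).trans h1, h2.trans (hy (Nat.zero_le k))⟩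
  · rintro ⟨h1, h2⟩
    have hex : ∃ k, y k < t := (hlim.eventually_lt_const h1).exists
    classical
    -- The first index with y < t is positive because t ≤ y 0; its predecessor labels the interval
    -- containing t.
    have hne : Nat.find hex ≠ 0 := fun h => (Nat.find_spec hex).not_ge (h ▸ h2)
    obtain ⟨k, hk⟩ := Nat.exists_eq_succ_of_ne_zero hne
    have hlt : y (k + 1) < t := Nat.succ_eq_add_one k ▸ hk ▸ Nat.find_spec hex
    refine ⟨k, hlt, not_lt.1 (Nat.find_min hex (m := k) ?_)⟩
    omega

theorem pairwise_disjoint_Ioc_succ {y : ℕ → ℝ} (hy : Antitone y) :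
    Pairwise (Function.onFun Disjoint fun k => Ioc (y (k + 1)) (y k)) :=
  hy.pairwise_disjoint_on_Ioc_succ

theorem lintegral_Ioi_eq_tsum {y : ℕ → ℝ} (hy : Antitone y) (hpos : ∀ k, 0 < y k)
    (hlim : Tendsto y atTop (𝓝 0)) (F : ℝ → ℝ≥0∞) :
    ∫⁻ t in Ioi 0, F t = (∑' k, ∫⁻ t in Ioc (y (k + 1)) (y k), F t) + ∫⁻ t in Ioi (y 0), F t := by
  rw [← Ioc_union_Ioi_eq_Ioi (hpos 0).le,
    lintegral_union measurableSet_Ioi (Ioc_disjoint_Ioi le_rfl), ← iUnion_Ioc_succ_eq hy hpos hlim,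
    lintegral_iUnion (fun _ => measurableSet_Ioc) (pairwise_disjoint_Ioc_succ hy)]

/-- The `K`-norm with weight `-t A'(t)` controls the sum over the dyadic level points of `A`. -/
theorem tsum_mul_le_lintegral_neg_deriv {A : ℝ → ℝ} (hA : AntitoneOn A (Ioi 0))
    (hac : AbsContOnPos A) (hlim : Tendsto A atTop (𝓝 0)) {y : ℕ → ℝ} (hy : Antitone y)
    (hpos : ∀ k, 0 < y k) (hlimy : Tendsto y atTop (𝓝 0))
    (hAy : ∀ k, A (y (k + 1)) = 2 * A (y k)) {K : ℝ → ℝ≥0∞} (hK : Monotone K) :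
    ∑' k, ENNReal.ofReal (A (y k)) * K (y k) ≤
      2 * ∫⁻ t in Ioi (0 : ℝ), ENNReal.ofReal (-deriv A t) * K t := by
  have hg : Measurable fun t => ENNReal.ofReal (-deriv A t) :=
    (measurable_deriv A).neg.ennreal_ofReal
  have h0 : ENNReal.ofReal (A (y 0)) * K (y 0) ≤
      ∫⁻ t in Ioi (y 0), ENNReal.ofReal (-deriv A t) * K t := by
    rw [← lintegral_neg_deriv_Ioi hA hac hlim (hpos 0), ← lintegral_mul_const _ hg]
    refine setLIntegral_mono (hg.mul hK.measurable) fun t ht => ?_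
    gcongr
    exact hK (le_of_lt ht)
  have h1 : ∀ k, ENNReal.ofReal (A (y (k + 1))) * K (y (k + 1)) ≤
      2 * ∫⁻ t in Ioc (y (k + 1)) (y k), ENNReal.ofReal (-deriv A t) * K t := by
    intro k
    -- Doubling gives A(y_{k+1}) - A(y_k) = A(y_k), so A(y_{k+1}) is exactly twice the mass of -A'
    -- on the interval. There K is at least its value at the left endpoint.
    have h2 : ENNReal.ofReal (A (y (k + 1))) =
        2 * ∫⁻ t in Ioc (y (k + 1)) (y k), ENNReal.ofReal (-deriv A t) := by
      rw [lintegral_neg_deriv_Ioc hA hac (hpos _) (hy (Nat.le_succ k)), hAy,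
        show 2 * A (y k) - A (y k) = A (y k) by ring, ENNReal.ofReal_mul zero_le_two]
      simp
    rw [h2, mul_assoc, ← lintegral_mul_const _ hg]
    gcongr 2 * ?_
    refine setLIntegral_mono (hg.mul hK.measurable) fun t ht => ?_
    gcongr
    exact hK ht.1.le
  rw [lintegral_Ioi_eq_tsum hy hpos hlimy,
    tsum_eq_zero_add' (f := fun k => ENNReal.ofReal (A (y k)) * K (y k)) ENNReal.summable, mul_add, add_comm,
    ← ENNReal.tsum_mul_left]
  refine add_le_add (ENNReal.tsum_le_tsum h1) (h0.trans ?_)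
  exact le_mul_of_one_le_left' one_le_two

/-- A function on `(0, ∞)` with `u(t) / t` equal to a multiple of `w k` on `(y (k + 1), z k]`. -/
theorem exists_stepFunction {E : Type*} [NormedAddCommGroup E] [NormedSpace ℝ E] {y z : ℕ → ℝ}
    (hy : Antitone y) (hpos : ∀ k, 0 < y k) (hlim : Tendsto y atTop (𝓝 0))
    (hz : ∀ k, z k ≤ y k) (w : ℕ → E) :
    ∃ u : ℝ → E, StronglyMeasurable u ∧
      (∀ k, ∀ t ∈ Ioc (y (k + 1)) (y k), u t =
        (Iic (z k)).indicator (fun t => (t * (z k - y (k + 1))⁻¹) • w k) t) ∧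
      ∀ t, y 0 < t → u t = 0 := by
  classical
  -- The alternative t ≤ 0 only makes the search total. For 0 < t ≤ y 0 the least such k is the
  -- index of the interval containing t.
  have hex : ∀ t : ℝ, ∃ k, y (k + 1) < t ∨ t ≤ 0 := by
    intro t
    rcases le_or_gt t 0 with h | h
    · exact ⟨0, .inr h⟩
    · obtain ⟨k, hk⟩ := ((hlim.comp (tendsto_add_atTop_nat 1)).eventually_lt_const h).exists
      exact ⟨k, .inl hk⟩
  set n : ℝ → ℕ := fun t => Nat.find (hex t) with hn
  have hnm : Measurable n := measurable_find hex fun k =>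
    (measurableSet_Ioi (a := y (k + 1))).union (measurableSet_Iic (a := (0 : ℝ)))
  have hzm : Measurable fun t => z (n t) := (measurable_of_countable z).comp hnm
  have hdm : Measurable fun t => (z (n t) - y (n t + 1))⁻¹ :=
    (measurable_of_countable fun k => (z k - y (k + 1))⁻¹).comp hnm
  refine ⟨fun t => {t | t ≤ z (n t)}.indicator
    (fun t => (t * (z (n t) - y (n t + 1))⁻¹) • w (n t)) t, ?_, ?_, ?_⟩
  · refine StronglyMeasurable.indicator ?_ (measurableSet_le measurable_id hzm)
    exact (measurable_id.mul hdm).stronglyMeasurable.smul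
      (StronglyMeasurable.of_discrete.comp_measurable hnm)
  · intro k t ht
    have hnt : n t = k := by
      refine (Nat.find_eq_iff _).2 ⟨.inl ht.1, fun j hj => ?_⟩
      rw [not_or, not_lt, not_le]
      exact ⟨ht.2.trans (hy hj), (hpos _).trans ht.1⟩
    simp only [indicator, mem_ofPred_eq, mem_Iic, hnt]
  -- Beyond y 0 the search also returns 0, but then t > z 0 and the indicator vanishes.
  · intro t ht
    have hnt : n t = 0 := by
      refine (Nat.find_eq_iff _).2 ⟨.inl ((hy zero_le_one).trans_lt ht), fun j hj => ?_⟩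
      omega
    refine indicator_of_notMem ?_ _
    rw [mem_ofPred_eq, hnt, not_le]
    exact (hz 0).trans_lt ht

/-- The integral of a step function with respect to `ds/s`. -/
theorem hasSum_integral_stepFunction {E F : Type*} [NormedAddCommGroup E] [NormedSpace ℝ E]
    [NormedAddCommGroup F] [NormedSpace ℝ F] [CompleteSpace F] (T : E →+ F) (hT : Continuous T)
    {y z : ℕ → ℝ} (hy : Antitone y) (hpos : ∀ k, 0 < y k) (hlim : Tendsto y atTop (𝓝 0))
    (hyz : ∀ k, y (k + 1) < z k) (hz : ∀ k, z k ≤ y k) {w : ℕ → E} {u : ℝ → E}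
    (hum : StronglyMeasurable u)
    (hu : ∀ k, ∀ t ∈ Ioc (y (k + 1)) (y k), u t =
        (Iic (z k)).indicator (fun t => (t * (z k - y (k + 1))⁻¹) • w k) t)
    (hu0 : ∀ t, y 0 < t → u t = 0) (hsum : ∑' k, ‖T (w k)‖ₑ ≠ ∞) :
    IntegrableOn (fun s : ℝ => s⁻¹ • T (u s)) (Ioi 0) ∧
      HasSum (fun k => T (w k)) (∫ s in Ioi (0 : ℝ), s⁻¹ • T (u s)) := by
  have hval : ∀ k, ∀ t ∈ Ioc (y (k + 1)) (y k), t⁻¹ • T (u t) =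
      (Iic (z k)).indicator (fun _ => (z k - y (k + 1))⁻¹ • T (w k)) t := by
    intro k t ht
    have ht0 : t ≠ 0 := ((hpos _).trans ht.1).ne'
    rw [hu k t ht]
    by_cases h : t ∈ Iic (z k)
    · rw [indicator_of_mem h, indicator_of_mem h, map_real_smul T hT, smul_smul,
        inv_mul_cancel_left₀ ht0]
    · rw [indicator_of_notMem h, indicator_of_notMem h, map_zero, smul_zero]
  have hinter : ∀ k, Ioc (y (k + 1)) (y k) ∩ Iic (z k) = Ioc (y (k + 1)) (z k) := fun k => by
    rw [Ioc_inter_Iic, min_eq_right (hz k)]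
  have hd : ∀ k, 0 < z k - y (k + 1) := fun k => sub_pos.2 (hyz k)
  have hzero : ∀ t ∈ Ioi (y 0), t⁻¹ • T (u t) = 0 := fun t ht => by
    rw [hu0 t ht, map_zero, smul_zero]
  have hint : IntegrableOn (fun s : ℝ => s⁻¹ • T (u s)) (Ioi 0) := by
    refine ⟨((by fun_prop : Measurable fun s : ℝ => s⁻¹).stronglyMeasurable.smul
      (hT.comp_stronglyMeasurable hum)).aestronglyMeasurable, ?_⟩
    rw [hasFiniteIntegral_iff_enorm, lintegral_Ioi_eq_tsum hy hpos hlim]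
    have e0 : ∫⁻ t in Ioi (y 0), ‖t⁻¹ • T (u t)‖ₑ = 0 := by
      rw [setLIntegral_congr_fun measurableSet_Ioi fun t ht => by rw [hzero t ht]]
      simp
    have e1 : ∀ k, ∫⁻ t in Ioc (y (k + 1)) (y k), ‖t⁻¹ • T (u t)‖ₑ = ‖T (w k)‖ₑ := by
      intro k
      rw [setLIntegral_congr_fun measurableSet_Ioc fun t ht => by
        rw [hval k t ht, enorm_indicator_eq_indicator_enorm],
        lintegral_indicator_const measurableSet_Iic, Measure.restrict_apply measurableSet_Iic,
        inter_comm, hinter, Real.volume_Ioc, enorm_smul, Real.enorm_of_nonneg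
        (inv_nonneg.2 (hd k).le), mul_right_comm, ← ENNReal.ofReal_mul (inv_nonneg.2 (hd k).le),
        inv_mul_cancel₀ (hd k).ne', ENNReal.ofReal_one, one_mul]
    rw [e0, add_zero]
    simpa only [e1] using hsum.lt_top
  refine ⟨hint, ?_⟩
  have hS := hasSum_integral_iUnion (fun _ => measurableSet_Ioc) (pairwise_disjoint_Ioc_succ hy)
    (hint.mono_set (t := Ioi 0) (s := ⋃ k, Ioc (y (k + 1)) (y k))
      (iUnion_subset fun k t ht => (hpos _).trans ht.1))
  have hI : ∫ s in Ioi (0 : ℝ), s⁻¹ • T (u s) =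
      ∫ s in ⋃ k, Ioc (y (k + 1)) (y k), s⁻¹ • T (u s) := by
    rw [iUnion_Ioc_succ_eq hy hpos hlim, ← Ioc_union_Ioi_eq_Ioi (hpos 0).le,
      setIntegral_union (Ioc_disjoint_Ioi le_rfl) measurableSet_Ioi
        (hint.mono_set Ioc_subset_Ioi_self) (hint.mono_set (Ioi_subset_Ioi (hpos 0).le)),
      setIntegral_eq_zero_of_forall_eq_zero hzero, add_zero]
  rw [hI]
  convert hS using 2 with k
  rw [setIntegral_congr_fun measurableSet_Ioc (hval k), setIntegral_indicator measurableSet_Iic]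
  rw [hinter, setIntegral_const, smul_smul, Real.volume_real_Ioc_of_le (hyz k).le,
    mul_inv_cancel₀ (hd k).ne', one_smul]


/-! ### From K to J: near-optimal decompositions and telescoping -/

section Couple

variable {𝕜 : Type*} [RCLike 𝕜]
  {V : Type*} [AddCommGroup V] [Module 𝕜 V] [TopologicalSpace V] [IsTopologicalAddGroup V]
  [ContinuousSMul 𝕜 V] [T2Space V]
  {X₀ : Type*} [NormedAddCommGroup X₀] [NormedSpace 𝕜 X₀] [CompleteSpace X₀]
  {X₁ : Type*} [NormedAddCommGroup X₁] [NormedSpace 𝕜 X₁] [CompleteSpace X₁]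
  (i₀ : X₀ →L[𝕜] V) (i₁ : X₁ →L[𝕜] V)

theorem InterSpace.enorm_zero : ‖(0 : InterSpace i₀ i₁)‖ₑ = 0 := by
  rw [InterSpace.enorm_eq]
  simp

theorem peetreK_interIncl_le (x : X₀) (t : ℝ) :
    peetreK i₀ (interIncl i₀ i₁) (i₀ x) t ≤ ‖x‖ₑ := by
  simpa [InterSpace.enorm_zero] using
    peetreK_le i₀ (interIncl i₀ i₁) (f := i₀ x) (t := t) x 0 (by simp)

/-- The triangle inequality in X₀, since the norm of X₀ ∩ X₁ dominates that of X₀. It shows K > 0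
for x ≠ 0 and t > 0, and ‖x‖ ≤ K(x, 1). -/
theorem le_peetreK_interIncl (hi₀ : Function.Injective i₀) (x : X₀) (t : ℝ) :
    ENNReal.ofReal (min 1 t) * ‖x‖ₑ ≤ peetreK i₀ (interIncl i₀ i₁) (i₀ x) t := by
  refine le_iInf₂ fun p hp => ?_
  have hx : x = p.1 + p.2.1.1 := hi₀ (by rw [map_add, ← hp, interIncl_apply])
  calc ENNReal.ofReal (min 1 t) * ‖x‖ₑ
      ≤ ENNReal.ofReal (min 1 t) * (‖p.1‖ₑ + ‖p.2.1.1‖ₑ) := by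
        gcongr
        rw [hx]
        exact enorm_add_le _ _
    _ = ENNReal.ofReal (min 1 t) * ‖p.1‖ₑ + ENNReal.ofReal (min 1 t) * ‖p.2.1.1‖ₑ := mul_add _ _ _
    _ ≤ ENNReal.ofReal 1 * ‖p.1‖ₑ + ENNReal.ofReal t * ‖p.2‖ₑ := by
        gcongr
        · exact min_le_left _ _
        · exact min_le_right _ _
        · rw [InterSpace.enorm_eq]
          exact le_max_left _ _
    _ = _ := by simp

/-- Near-optimal decompositions for the `K`-functional of the couple `(X₀, X₀ ∩ X₁)`. -/
theorem exists_near_optimal (hi₀ : Function.Injective i₀) (x : X₀) {t : ℝ} (ht : 0 < t) :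
    ∃ p : InterSpace i₀ i₁, ‖x - p.1.1‖ₑ + ENNReal.ofReal t * ‖p‖ₑ ≤
      2 * peetreK i₀ (interIncl i₀ i₁) (i₀ x) t := by
  -- For x = 0 the functional vanishes and K < 2K fails, so this case is treated separately.
  rcases eq_or_ne x 0 with rfl | hx
  · exact ⟨0, by simp [InterSpace.enorm_zero]⟩
  have h0 : peetreK i₀ (interIncl i₀ i₁) (i₀ x) t ≠ 0 := by
    refine (lt_of_lt_of_le ?_ (le_peetreK_interIncl i₀ i₁ hi₀ x t)).ne'
    refine ENNReal.mul_pos ?_ (by simpa using hx)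
    simpa using ht
  have htop : peetreK i₀ (interIncl i₀ i₁) (i₀ x) t ≠ ∞ :=
    ((peetreK_interIncl_le i₀ i₁ x t).trans_lt enorm_lt_top).ne
  have hlt : peetreK i₀ (interIncl i₀ i₁) (i₀ x) t <
      2 * peetreK i₀ (interIncl i₀ i₁) (i₀ x) t := by
    rw [two_mul]
    exact ENNReal.lt_add_right htop h0
  conv_lhs at hlt => unfold peetreK
  obtain ⟨p, hp⟩ := iInf_lt_iff.1 hlt
  obtain ⟨hpx, hp⟩ := iInf_lt_iff.1 hp
  have hx' : x - p.2.1.1 = p.1 :=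
    sub_eq_of_eq_add (hi₀ (by rw [map_add, ← hpx, interIncl_apply]))
  exact ⟨p.2, by rw [hx']; exact hp.le⟩

/-- The real structure on E need not come from 𝕜: every continuous additive map is real-linear.
Applied to the two components of X₀ ∩ X₁. -/
theorem enorm_map_real_smul {E F : Type*} [NormedAddCommGroup E] [NormedSpace 𝕜 E]
    [NormedAddCommGroup F] [NormedSpace 𝕜 F] [NormedSpace ℝ E] (T : E →L[𝕜] F) {r : ℝ}
    (hr : 0 ≤ r) (y : E) : ‖T (r • y)‖ₑ = ENNReal.ofReal r * ‖T y‖ₑ := by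
  let : NormedSpace ℝ F := NormedSpace.restrictScalars ℝ 𝕜 F
  rw [map_real_smul T T.continuous, enorm_smul, Real.enorm_of_nonneg hr]

theorem peetreJ_real_smul [NormedSpace ℝ (InterSpace i₀ i₁)] {r : ℝ} (hr : 0 ≤ r)
    (y : InterSpace i₀ i₁) (t : ℝ) :
    peetreJ i₀ i₁ (r • y) t = ENNReal.ofReal r * peetreJ i₀ i₁ y t := by
  have h0 : ‖(r • y).1.1‖ₑ = ENNReal.ofReal r * ‖y.1.1‖ₑ :=
    enorm_map_real_smul (interFst i₀ i₁) hr y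
  have h1 : ‖(r • y).1.2‖ₑ = ENNReal.ofReal r * ‖y.1.2‖ₑ :=
    enorm_map_real_smul
      ((ContinuousLinearMap.snd 𝕜 X₀ X₁).comp (interSubmodule i₀ i₁).subtypeL) hr y
  rw [peetreJ, h0, h1, mul_left_comm, ← mul_max]
  rfl

theorem peetreJ_mono (y : InterSpace i₀ i₁) : Monotone (peetreJ i₀ i₁ y) := fun s t h => by
  unfold peetreJ
  gcongr

/-- The bounds on w_k hold at the left endpoint y_{k+1}; this carries them up to 2 y_{k+1} at the
price of a factor 2. -/
theorem peetreJ_two_mul_le (y : InterSpace i₀ i₁) (t : ℝ) {D : ℝ≥0∞} (h0 : ‖y.1.1‖ₑ ≤ D)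
    (h1 : ENNReal.ofReal t * ‖y‖ₑ ≤ D) : peetreJ i₀ i₁ y (2 * t) ≤ 2 * D := by
  refine max_le (h0.trans (le_mul_of_one_le_left' one_le_two)) ?_
  rw [ENNReal.ofReal_mul zero_le_two, mul_assoc, ENNReal.ofReal_ofNat]
  gcongr
  refine le_trans ?_ h1
  gcongr
  rw [InterSpace.enorm_eq]
  exact le_max_right _ _

/-- The embedding of `(X₀, X₀ ∩ X₁)_{0,1,B;K}` into `(X₀, X₁)_{0,1,a;J}`. -/
theorem jNorm_le_weightedNorm_peetreK (hi₀ : Function.Injective i₀) {a A B : ℝ → ℝ}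
    (ha : StrictAntiOn a (Ioi 0)) (hcont : ContinuousOn a (Ioi 0))
    (halim : Tendsto a (𝓝[>] 0) atTop) (ha1 : 0 < a 1)
    (hA : AntitoneOn A (Ioi 0)) (hac : AbsContOnPos A) (hAlim : Tendsto A atTop (𝓝 0))
    (hAa : ∀ t, 0 < t → t ≤ 1 → A t = a t)
    (hB : ∀ᵐ x ∂(volume.restrict (Ioi (0 : ℝ))), B x = -x * deriv A x) (x : X₀) :
    jNorm i₀ i₁ 0 1 a (i₀ x) ≤
      32 * weightedNorm 0 1 B (peetreK i₀ (interIncl i₀ i₁) (i₀ x)) := by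
  let : NormedSpace ℝ (InterSpace i₀ i₁) := NormedSpace.restrictScalars ℝ 𝕜 _
  set K := peetreK i₀ (interIncl i₀ i₁) (i₀ x) with hK
  have hKmono : Monotone K := peetreK_mono _ _ _
  obtain ⟨y, hy0, hyanti, hypos, hya, hylim⟩ := exists_dyadic_level_points ha hcont halim ha1
  have hyle : ∀ k, y k ≤ 1 := fun k => hy0 ▸ hyanti.antitone (Nat.zero_le k)
  have hAy : ∀ k, A (y k) = a (y k) := fun k => hAa _ (hypos k) (hyle k)
  have hasucc : ∀ k, a (y (k + 1)) = 2 * a (y k) := fun k => by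
    rw [hya, hya, pow_succ]; ring
  set M := weightedNorm 0 1 B K with hM
  have hMeq : M = ∫⁻ t in Ioi (0 : ℝ), ENNReal.ofReal (-deriv A t) * K t := by
    rw [hM, weightedNorm_zero_one]
    refine lintegral_congr_ae ?_
    filter_upwards [hB, ae_restrict_mem measurableSet_Ioi] with t hBt ht
    have ht0 : t ≠ 0 := (mem_Ioi.1 ht).ne'
    rw [hBt, show t⁻¹ * (-t * deriv A t) = -deriv A t by field_simp]
  have hsum : ∑' k, ENNReal.ofReal (a (y k)) * K (y k) ≤ 2 * M := by
    rw [hMeq]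
    refine le_trans (le_of_eq ?_) (tsum_mul_le_lintegral_neg_deriv hA hac hAlim hyanti.antitone
      hypos hylim (fun k => by rw [hAy, hAy, hasucc]) hKmono)
    simp only [hAy]
  rcases eq_or_ne M ∞ with htop | htop
  · rw [htop, ENNReal.mul_top (by norm_num)]
    exact le_top
  -- Since a(y_k) ≥ a(1) > 0. This gives convergence of Σ w_k in the sum space and K(y_k) → 0, hence
  -- p_k → x in X₀.
  have hKsum : ∑' k, K (y k) ≠ ∞ := by
    have h1 : ENNReal.ofReal (a 1) * ∑' k, K (y k) ≤ 2 * M := by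
      rw [← ENNReal.tsum_mul_left]
      refine le_trans (ENNReal.tsum_le_tsum fun k => ?_) hsum
      gcongr
      exact ha.antitoneOn (hypos k) (mem_Ioi.2 one_pos) (hyle k)
    refine (ENNReal.lt_top_of_mul_ne_top_right
      (h1.trans_lt (ENNReal.mul_lt_top (by simp) htop.lt_top)).ne ?_).ne
    simpa using ha1
  -- At y_0 = 1 the choice p_0 = 0 is admissible because ‖x‖ ≤ K(1). The telescoping series then
  -- sums to x with no remainder at the large end.
  have hp : ∀ k, ∃ p : InterSpace i₀ i₁,
      ‖x - p.1.1‖ₑ + ENNReal.ofReal (y k) * ‖p‖ₑ ≤ 2 * K (y k) ∧ (k = 0 → p = 0) := by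
    intro k
    rcases Nat.eq_zero_or_pos k with rfl | hk
    · refine ⟨0, ?_, fun _ => rfl⟩
      have h1 : ‖x‖ₑ ≤ K (y 0) := by
        have := le_peetreK_interIncl i₀ i₁ hi₀ x 1
        rw [min_self, ENNReal.ofReal_one, one_mul] at this
        rwa [hy0]
      have : ‖x‖ₑ ≤ 2 * K (y 0) := h1.trans (le_mul_of_one_le_left' one_le_two)
      simpa [InterSpace.enorm_zero] using this
    · obtain ⟨p, hp⟩ := exists_near_optimal i₀ i₁ hi₀ x (hypos k)
      exact ⟨p, hp, fun h => absurd h hk.ne'⟩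
  choose p hpK hp0 using hp
  have hp0 : p 0 = 0 := hp0 0 rfl
  set w : ℕ → InterSpace i₀ i₁ := fun k => p (k + 1) - p k with hw
  have hKs : ∀ k, K (y (k + 1)) ≤ K (y k) := fun k => hKmono (hyanti.antitone (Nat.le_succ k))
  have hw0 : ∀ k, ‖(w k).1.1‖ₑ ≤ 4 * K (y k) := by
    intro k
    have h1 : (w k).1.1 = (x - (p k).1.1) - (x - (p (k + 1)).1.1) := by
      rw [sub_sub_sub_cancel_left]; rfl
    calc ‖(w k).1.1‖ₑ ≤ ‖x - (p k).1.1‖ₑ + ‖x - (p (k + 1)).1.1‖ₑ := h1 ▸ enorm_sub_le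
      _ ≤ 2 * K (y k) + 2 * K (y (k + 1)) :=
        add_le_add (le_self_add.trans (hpK k)) (le_self_add.trans (hpK (k + 1)))
      _ ≤ 2 * K (y k) + 2 * K (y k) := by gcongr; exact hKs k
      _ = 4 * K (y k) := by rw [← add_mul]; norm_num
  have hw1 : ∀ k, ENNReal.ofReal (y (k + 1)) * ‖w k‖ₑ ≤ 4 * K (y k) := by
    intro k
    calc ENNReal.ofReal (y (k + 1)) * ‖w k‖ₑ
        ≤ ENNReal.ofReal (y (k + 1)) * (‖p (k + 1)‖ₑ + ‖p k‖ₑ) := by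
          gcongr
          exact enorm_sub_le
      _ = ENNReal.ofReal (y (k + 1)) * ‖p (k + 1)‖ₑ + ENNReal.ofReal (y (k + 1)) * ‖p k‖ₑ :=
          mul_add _ _ _
      _ ≤ 2 * K (y (k + 1)) + ENNReal.ofReal (y k) * ‖p k‖ₑ := by
          refine add_le_add (le_add_self.trans (hpK (k + 1))) ?_
          gcongr
          exact hyanti.antitone (Nat.le_succ k)
      _ ≤ 2 * K (y k) + 2 * K (y k) := by
          refine add_le_add ?_ (le_add_self.trans (hpK k))
          gcongr
          exact hKs k
      _ = 4 * K (y k) := by rw [← add_mul]; norm_num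
  -- The ratio y_k / y_{k+1} is not bounded, so w_k is placed only on t ≤ 2 y_{k+1}, where t‖w_k‖
  -- stays comparable to K(y_k).
  set z : ℕ → ℝ := fun k => min (2 * y (k + 1)) (y k) with hz
  have hzy : ∀ k, z k ≤ y k := fun k => min_le_right _ _
  have hyz : ∀ k, y (k + 1) < z k := fun k =>
    lt_min (by linarith [hypos (k + 1)]) (hyanti (Nat.lt_succ_self k))
  obtain ⟨u, hum, hu, hu0⟩ := exists_stepFunction hyanti.antitone hypos hylim hzy w
  let T : InterSpace i₀ i₁ →L[𝕜] SumSpace i₀ i₁ := (inlSum i₀ i₁).comp (interFst i₀ i₁)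
  have hTw : ∑' k, ‖T (w k)‖ₑ ≠ ∞ := by
    have : ∑' k, ‖T (w k)‖ₑ ≤ 4 * ∑' k, K (y k) := by
      rw [← ENNReal.tsum_mul_left]
      exact ENNReal.tsum_le_tsum fun k => (enorm_inlSum_le i₀ i₁ _).trans (hw0 k)
    exact (this.trans_lt (ENNReal.mul_lt_top (by simp) hKsum.lt_top)).ne
  obtain ⟨hint, hS⟩ := hasSum_integral_stepFunction (T : InterSpace i₀ i₁ →+ SumSpace i₀ i₁)
    T.continuous hyanti.antitone hypos hylim hyz hzy hum hu hu0 hTw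
  have hlimT : Tendsto (fun n => T (p n)) atTop (𝓝 (inlSum i₀ i₁ x)) := by
    have h1 : Tendsto (fun n => (p n).1.1) atTop (𝓝 x) := by
      rw [tendsto_iff_edist_tendsto_0]
      have h2 : Tendsto (fun k => 2 * K (y k)) atTop (𝓝 0) := by
        simpa using ENNReal.Tendsto.const_mul
          (ENNReal.tendsto_atTop_zero_of_tsum_ne_top hKsum) (.inr ENNReal.ofNat_ne_top)
      refine tendsto_of_tendsto_of_tendsto_of_le_of_le tendsto_const_nhds h2
        (fun _ => zero_le) fun k => ?_
      rw [edist_comm, edist_eq_enorm_sub]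
      exact le_self_add.trans (hpK k)
    exact ((inlSum i₀ i₁).continuous.tendsto x).comp h1
  have hval : ∫ s in Ioi (0 : ℝ), s⁻¹ • interToSum i₀ i₁ (u s) = inlSum i₀ i₁ x := by
    refine tendsto_nhds_unique hS.tendsto_sum_nat (hlimT.congr fun n => ?_)
    have : ∑ k ∈ Finset.range n, (T (p (k + 1)) - T (p k)) = T (p n) - T (p 0) :=
      Finset.sum_range_sub (fun k => T (p k)) n
    rw [hp0, map_zero, sub_zero] at this
    rw [← this]
    refine Finset.sum_congr rfl fun k _ => ?_
    exact (map_sub T _ _).symm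
  have hrep : IsRepresentation i₀ i₁ (i₀ x) u :=
    ⟨hum.aestronglyMeasurable, hint, by rw [hval, sumIncl_inlSum]⟩
  refine (iInf₂_le u hrep).trans ?_
  rw [weightedNorm_zero_one, lintegral_Ioi_eq_tsum hyanti.antitone hypos hylim]
  have e0 : ∫⁻ t in Ioi (y 0), ENNReal.ofReal (t⁻¹ * a t) * peetreJ i₀ i₁ (u t) t = 0 := by
    rw [setLIntegral_congr_fun measurableSet_Ioi fun t ht => by
      rw [hu0 t ht, peetreJ_zero, mul_zero]]
    simp
  have e1 : ∀ k, ∫⁻ t in Ioc (y (k + 1)) (y k),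
      ENNReal.ofReal (t⁻¹ * a t) * peetreJ i₀ i₁ (u t) t ≤
        16 * (ENNReal.ofReal (a (y k)) * K (y k)) := by
    intro k
    have hd : 0 < z k - y (k + 1) := sub_pos.2 (hyz k)
    -- On the support a ≤ a(y_{k+1}) = 2 a(y_k) and J(w_k, t) ≤ 2 · 4 K(y_k), whence the constant
    -- 16.
    set D : ℝ≥0∞ := ENNReal.ofReal (2 * a (y k)) * (2 * (4 * K (y k))) with hD
    have hJ : ∀ t ≤ z k, peetreJ i₀ i₁ (w k) t ≤ 2 * (4 * K (y k)) := fun t ht =>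
      (peetreJ_mono i₀ i₁ _ (ht.trans (min_le_left _ _))).trans
        (peetreJ_two_mul_le i₀ i₁ _ _ (hw0 k) (hw1 k))
    calc _ ≤ ∫⁻ t in Ioc (y (k + 1)) (y k), (Ioc (y (k + 1)) (z k)).indicator
          (fun _ => ENNReal.ofReal (z k - y (k + 1))⁻¹ * D) t := by
          refine lintegral_mono_ae ?_
          filter_upwards [ae_restrict_mem measurableSet_Ioc] with t ht
          have ht0 : 0 < t := (hypos _).trans ht.1
          rw [hu k t ht]
          by_cases h : t ≤ z k
          · rw [indicator_of_mem (mem_Iic.2 h), indicator_of_mem (mem_Ioc.2 ⟨ht.1, h⟩),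
              peetreJ_real_smul i₀ i₁ (by positivity), ← mul_assoc, hD, ← mul_assoc]
            gcongr ?_ * ?_
            · rw [← ENNReal.ofReal_mul' (by positivity), ← ENNReal.ofReal_mul (by positivity)]
              apply ENNReal.ofReal_le_ofReal
              have h1 : t⁻¹ * a t * (t * (z k - y (k + 1))⁻¹) = (z k - y (k + 1))⁻¹ * a t := by
                field_simp
              rw [h1, ← hasucc]
              gcongr
              exact ha.antitoneOn (hypos _) ht0 ht.1.le
            · exact hJ t h
          · rw [indicator_of_notMem (by simpa using h), peetreJ_zero, mul_zero]
            exact zero_le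
      _ = D := by
          rw [lintegral_indicator_const measurableSet_Ioc,
            Measure.restrict_apply measurableSet_Ioc,
            inter_eq_left.2 (Ioc_subset_Ioc_right (hzy k)), Real.volume_Ioc, mul_right_comm,
            ← ENNReal.ofReal_mul (inv_nonneg.2 hd.le), inv_mul_cancel₀ hd.ne',
            ENNReal.ofReal_one, one_mul]
      _ = _ := by
          rw [hD, ENNReal.ofReal_mul zero_le_two, ENNReal.ofReal_ofNat]
          ring
  rw [e0, add_zero]
  calc _ ≤ ∑' k, 16 * (ENNReal.ofReal (a (y k)) * K (y k)) := ENNReal.tsum_le_tsum e1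
    _ = 16 * ∑' k, ENNReal.ofReal (a (y k)) * K (y k) := ENNReal.tsum_mul_left
    _ ≤ 16 * (2 * M) := by gcongr
    _ = 32 * M := by rw [← mul_assoc]; norm_num

end Couple


/-! ### The pasted weight and the closing of the cycle -/

theorem AbsContOnPos.continuousOn {f : ℝ → ℝ} (hf : AbsContOnPos f) : ContinuousOn f (Ioi 0) := by
  intro x hx
  have hx0 : 0 < x := hx
  have h := (hf (x / 2) (2 * x) (by positivity) (by linarith)).continuousOn
  rw [uIcc_of_le (by linarith)] at h
  exact (h.continuousAt (Icc_mem_nhds (by linarith) (by linarith))).continuousWithinAt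

/-- The properties of a function pasted together at `1` from two slowly varying functions. -/
theorem pasted_weight_properties {a α A : ℝ → ℝ} {c : ℝ} (hc : 0 < c) (ha_sv : SlowlyVarying a)
    (ha_anti : AntitoneOn a (Ioi 0)) (hα_sv : SlowlyVarying α) (hα_ac : AbsContOnPos α)
    (hα_anti : AntitoneOn α (Ioi 0)) (hα_infty : Tendsto α atTop (𝓝 0))
    (hA_le : ∀ x : ℝ, 0 < x → x ≤ 1 → A x = a x) (hA_gt : ∀ x : ℝ, 1 < x → A x = c * α x)
    (hA_ac : AbsContOnPos A) :
    AntitoneOn A (Ioi 0) ∧ Tendsto A atTop (𝓝 0) ∧ (∀ t, 0 < t → 0 < A t) ∧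
      ∃ C : ℝ, 0 < C ∧
        ∀ x y : ℝ, 0 < x → x ≤ y → x ^ (1 / 2 : ℝ) * A x ≤ C * (y ^ (1 / 2 : ℝ) * A y) := by
  -- Continuity of A at 1 forces the two branches to agree there; this is the only condition on c
  -- besides its sign.
  have hA1 : A 1 = c * α 1 := by
    have h1 : ContinuousAt A 1 := hA_ac.continuousOn.continuousAt (Ioi_mem_nhds one_pos)
    have h2 : ContinuousAt (fun x => c * α x) 1 :=
      (hα_ac.continuousOn.continuousAt (Ioi_mem_nhds one_pos)).const_mul c
    refine tendsto_nhds_unique (h1.tendsto.mono_left nhdsWithin_le_nhds : Tendsto A (𝓝[>] 1) _) ?_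
    refine (h2.tendsto.mono_left nhdsWithin_le_nhds).congr' ?_
    filter_upwards [self_mem_nhdsWithin] with x hx
    exact (hA_gt x hx).symm
  have hA_ge : ∀ x : ℝ, 1 ≤ x → A x = c * α x := fun x hx =>
    hx.eq_or_lt.elim (fun h => h ▸ hA1) (hA_gt x)
  have hpos : ∀ t, 0 < t → 0 < A t := by
    intro t ht
    rcases le_total t 1 with h | h
    · rw [hA_le t ht h]
      exact ha_sv.pos t ht
    · rw [hA_ge t h]
      exact mul_pos hc (hα_sv.pos t ht)
  have one_mem : (1 : ℝ) ∈ Ioi (0 : ℝ) := mem_Ioi.2 one_pos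
  have hle1 : ∀ x, 0 < x → x ≤ 1 → A 1 ≤ A x := fun x hx h => by
    rw [hA_le x hx h, hA_le 1 zero_lt_one le_rfl]
    exact ha_anti hx one_mem h
  have hge1 : ∀ x, 1 ≤ x → A x ≤ A 1 := fun x h => by
    rw [hA_ge x h, hA1]
    exact mul_le_mul_of_nonneg_left (hα_anti one_mem (zero_lt_one.trans_le h) h) hc.le
  refine ⟨?_, ?_, hpos, ?_⟩
  · intro x hx y hy hxy
    rcases le_total y 1 with h | h
    · rw [hA_le x hx (hxy.trans h), hA_le y hy h]
      exact ha_anti hx hy hxy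
    rcases le_total x 1 with h' | h'
    · exact (hge1 y h).trans (hle1 x hx h')
    · rw [hA_ge x h', hA_ge y h]
      exact mul_le_mul_of_nonneg_left (hα_anti hx hy hxy) hc.le
  · have h := hα_infty.const_mul c
    rw [mul_zero] at h
    refine h.congr' ?_
    filter_upwards [eventually_gt_atTop 1] with x hx
    exact (hA_gt x hx).symm
  · obtain ⟨C₁, hC₁, h₁⟩ := ha_sv.exists_rpow_mul_le (half_pos one_pos)
    obtain ⟨C₂, hC₂, h₂⟩ := hα_sv.exists_rpow_mul_le (half_pos one_pos)
    have k₁ : ∀ x y : ℝ, 0 < x → x ≤ y → y ≤ 1 →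
        x ^ (1 / 2 : ℝ) * A x ≤ C₁ * (y ^ (1 / 2 : ℝ) * A y) := fun x y hx hxy hy => by
      rw [hA_le x hx (hxy.trans hy), hA_le y (hx.trans_le hxy) hy]
      exact h₁ x y hx hxy
    have k₂ : ∀ x y : ℝ, 1 ≤ x → x ≤ y →
        x ^ (1 / 2 : ℝ) * A x ≤ C₂ * (y ^ (1 / 2 : ℝ) * A y) := fun x y hx hxy => by
      rw [hA_ge x hx, hA_ge y (hx.trans hxy)]
      have := mul_le_mul_of_nonneg_left (h₂ x y (zero_lt_one.trans_le hx) hxy) hc.le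
      linarith
    -- C₁ serves y ≤ 1, C₂ serves x ≥ 1, and C₁ C₂ serves x ≤ 1 ≤ y by passing through the point 1.
    refine ⟨C₁ + C₂ + C₁ * C₂, by positivity, fun x y hx hxy => ?_⟩
    have hy : 0 < y := hx.trans_le hxy
    have hP : 0 < y ^ (1 / 2 : ℝ) * A y := mul_pos (by positivity) (hpos y hy)
    have hstep : ∀ D : ℝ, D ≤ C₁ + C₂ + C₁ * C₂ → x ^ (1 / 2 : ℝ) * A x ≤
        D * (y ^ (1 / 2 : ℝ) * A y) →
        x ^ (1 / 2 : ℝ) * A x ≤ (C₁ + C₂ + C₁ * C₂) * (y ^ (1 / 2 : ℝ) * A y) := fun D hD h =>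
      h.trans (mul_le_mul_of_nonneg_right hD hP.le)
    have hC : 0 < C₁ * C₂ := mul_pos hC₁ hC₂
    rcases le_total y 1 with h | h
    · exact hstep C₁ (by linarith) (k₁ x y hx hxy h)
    rcases le_total x 1 with h' | h'
    · refine hstep (C₁ * C₂) (by linarith) ((k₁ x 1 hx h' le_rfl).trans ?_)
      rw [mul_assoc]
      exact mul_le_mul_of_nonneg_left (k₂ 1 y le_rfl h) hC₁.le
    · exact hstep C₂ (by linarith) (k₂ x y h' hxy)

/-- An infimum over no representations is ∞, so membership in a J-space reduces to finiteness of its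
norm. -/
theorem exists_isRepresentation_of_jNorm_lt_top {𝕜 : Type*} [RCLike 𝕜]
    {V : Type*} [AddCommGroup V] [Module 𝕜 V] [TopologicalSpace V] [IsTopologicalAddGroup V]
    [ContinuousSMul 𝕜 V] [T2Space V] {X₀ : Type*} [NormedAddCommGroup X₀] [NormedSpace 𝕜 X₀]
    {X₁ : Type*} [NormedAddCommGroup X₁] [NormedSpace 𝕜 X₁] (i₀ : X₀ →L[𝕜] V) (i₁ : X₁ →L[𝕜] V)
    {θ : ℝ} {q : ℝ≥0∞} {v : ℝ → ℝ} {f : V} (h : jNorm i₀ i₁ θ q v f < ∞) :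
    ∃ u, IsRepresentation i₀ i₁ f u := by
  obtain ⟨u, hu⟩ := iInf_lt_iff.1 h
  obtain ⟨hr, -⟩ := iInf_lt_iff.1 hu
  exact ⟨u, hr⟩

end LimitingInterpolation

end

theorem theorem1p18 {𝕜 : Type*} [RCLike 𝕜]
    {V : Type*} [AddCommGroup V] [Module 𝕜 V] [TopologicalSpace V] [IsTopologicalAddGroup V]
    [ContinuousSMul 𝕜 V] [T2Space V]
    {X₀ : Type*} [NormedAddCommGroup X₀] [NormedSpace 𝕜 X₀] [CompleteSpace X₀]
    {X₁ : Type*} [NormedAddCommGroup X₁] [NormedSpace 𝕜 X₁] [CompleteSpace X₁]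
    (i₀ : X₀ →L[𝕜] V) (hi₀ : Function.Injective i₀)
    (i₁ : X₁ →L[𝕜] V) (hi₁ : Function.Injective i₁)
    (a : ℝ → ℝ) (ha_sv : LimitingInterpolation.SlowlyVarying a)
    (ha_ac : LimitingInterpolation.AbsContOnPos a)
    (ha_anti : StrictAntiOn a (Ioi (0 : ℝ)))
    (ha_zero : Tendsto a (𝓝[>] (0 : ℝ)) atTop)
    (ha_infty : ∃ L : ℝ, 0 < L ∧ Tendsto a atTop (𝓝 L))
    (α : ℝ → ℝ) (hα_sv : LimitingInterpolation.SlowlyVarying α)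
    (hα_ac : LimitingInterpolation.AbsContOnPos α)
    (hα_anti : StrictAntiOn α (Ioi (0 : ℝ)))
    (hα_zero : Tendsto α (𝓝[>] (0 : ℝ)) atTop)
    (hα_infty : Tendsto α atTop (𝓝 0))
    (c : ℝ) (hc : 0 < c)
    (A : ℝ → ℝ) (hA_le : ∀ x : ℝ, 0 < x → x ≤ 1 → A x = a x)
    (hA_gt : ∀ x : ℝ, 1 < x → A x = c * α x)
    (hA_ac : LimitingInterpolation.AbsContOnPos A)
    (B : ℝ → ℝ) (hB : ∀ᵐ x ∂(volume.restrict (Ioi (0 : ℝ))), B x = -x * deriv A x) :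
    (LimitingInterpolation.jSpace i₀ i₁ 0 1 a).Coincides
        (LimitingInterpolation.jSpace i₀ (LimitingInterpolation.interIncl i₀ i₁) 0 1 A) ∧
      (LimitingInterpolation.jSpace i₀ (LimitingInterpolation.interIncl i₀ i₁) 0 1 A).Coincides
        (LimitingInterpolation.kSpace i₀ (LimitingInterpolation.interIncl i₀ i₁) 0 1 B) := by
  have ha0 : ∀ t, 0 < t → 0 < a t := ha_sv.pos
  obtain ⟨L, hL, hLlim⟩ := ha_infty
  have haL : ∀ t, 0 < t → L ≤ a t := fun t ht => by
    refine le_of_tendsto hLlim ?_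
    filter_upwards [eventually_ge_atTop t] with s hs
    exact ha_anti.antitoneOn ht (ht.trans_le hs) hs
  obtain ⟨hA_anti, hA_lim, hA_pos, C, hC, hAC⟩ :=
    LimitingInterpolation.pasted_weight_properties hc ha_sv ha_anti.antitoneOn hα_sv hα_ac
      hα_anti.antitoneOn hα_infty hA_le hA_gt hA_ac
  have hA1 : ∀ t, 1 ≤ t → A t ≤ a 1 := fun t ht => by
    rw [← hA_le 1 one_pos le_rfl]
    exact hA_anti (mem_Ioi.2 one_pos) (zero_lt_one.trans_le ht) ht
  set j := LimitingInterpolation.interIncl i₀ i₁ with hj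
  set N₁ := LimitingInterpolation.jNorm i₀ i₁ 0 1 a with hN₁
  set N₂ := LimitingInterpolation.jNorm i₀ j 0 1 A with hN₂
  set N₃ : V → ℝ≥0∞ := fun f =>
    LimitingInterpolation.weightedNorm 0 1 B (LimitingInterpolation.peetreK i₀ j f) with hN₃
  obtain ⟨D₁, h21⟩ : ∃ D : ℝ≥0, ∀ f, N₂ f ≤ D * N₁ f := by
    refine ⟨(1 + 2 * a 1 / L).toNNReal, fun f => ?_⟩
    -- A nonzero constant is needed to move it inside an infimum that may be over the empty family,
    -- where 0 · ∞ = 0 would spoil the identity.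
    have hD : ((1 + 2 * a 1 / L).toNNReal : ℝ≥0∞) ≠ 0 := by
      have := ha0 1 one_pos
      simp only [ne_eq, ENNReal.coe_eq_zero, Real.toNNReal_eq_zero, not_le]
      positivity
    rw [hN₁]
    unfold LimitingInterpolation.jNorm
    rw [ENNReal.mul_iInf_of_ne hD ENNReal.coe_ne_top]
    refine le_iInf fun u => ?_
    rw [ENNReal.mul_iInf_of_ne hD ENNReal.coe_ne_top]
    exact le_iInf fun hu =>
      LimitingInterpolation.jNorm_interIncl_le i₀ i₁ hL haL hA_le hA1 hu
  obtain ⟨D₂, h32⟩ : ∃ D : ℝ≥0, ∀ f, N₃ f ≤ D * N₂ f := by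
    refine ⟨(2 * C).toNNReal, fun f => ?_⟩
    have hD : ((2 * C).toNNReal : ℝ≥0∞) ≠ 0 := by
      simp only [ne_eq, ENNReal.coe_eq_zero, Real.toNNReal_eq_zero, not_le]
      positivity
    rw [hN₂]
    unfold LimitingInterpolation.jNorm
    rw [ENNReal.mul_iInf_of_ne hD ENNReal.coe_ne_top]
    refine le_iInf fun u => ?_
    rw [ENNReal.mul_iInf_of_ne hD ENNReal.coe_ne_top]
    refine le_iInf fun hu => ?_
    let : NormedSpace ℝ X₀ := NormedSpace.restrictScalars ℝ 𝕜 X₀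
    let : NormedSpace ℝ (LimitingInterpolation.InterSpace i₀ i₁) :=
      NormedSpace.restrictScalars ℝ 𝕜 _
    exact LimitingInterpolation.weightedNorm_peetreK_le_weightedNorm_peetreJ i₀ j hB
      (by positivity) (fun s hs => LimitingInterpolation.lintegral_neg_deriv_mul_min_le hA_anti
        hA_ac hA_lim hC hA_pos hAC hs) hu
  -- The second space of the couple lies in X₀, so the sum is X₀ itself.
  have hrange : ∀ f, f ∈ range (LimitingInterpolation.sumIncl i₀ j) → ∃ x, i₀ x = f := by
    rintro f ⟨s, rfl⟩
    obtain ⟨p, rfl⟩ := Submodule.Quotient.mk_surjective _ s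
    refine ⟨p.fst + p.snd.1.1, ?_⟩
    rw [map_add]
    rfl
  have h13 : ∀ f, f ∈ range (LimitingInterpolation.sumIncl i₀ j) →
      N₁ f ≤ (32 : ℝ≥0) * N₃ f := by
    intro f hf
    obtain ⟨x, rfl⟩ := hrange f hf
    exact LimitingInterpolation.jNorm_le_weightedNorm_peetreK i₀ i₁ hi₀ ha_anti
      ha_ac.continuousOn ha_zero (ha0 1 one_pos) hA_anti hA_ac hA_lim hA_le hB x
  have hmem : ∀ f, N₂ f < ∞ → f ∈ range (LimitingInterpolation.sumIncl i₀ j) := fun f h => by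
    obtain ⟨u, hu⟩ := LimitingInterpolation.exists_isRepresentation_of_jNorm_lt_top i₀ j h
    exact ⟨_, hu.eq_integral⟩
  have l21 : ∀ f, N₁ f < ∞ → N₂ f < ∞ := fun f h =>
    (h21 f).trans_lt (ENNReal.mul_lt_top ENNReal.coe_lt_top h)
  have l32 : ∀ f, N₂ f < ∞ → N₃ f < ∞ := fun f h =>
    (h32 f).trans_lt (ENNReal.mul_lt_top ENNReal.coe_lt_top h)
  have l13 : ∀ f, f ∈ range (LimitingInterpolation.sumIncl i₀ j) → N₃ f < ∞ → N₁ f < ∞ :=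
    fun f hf h => (h13 f hf).trans_lt (ENNReal.mul_lt_top ENNReal.coe_lt_top h)
  -- In each maximum one entry is a direct estimate and the other is the composition of the two
  -- remaining ones around the cycle.
  refine ⟨⟨?_, max D₁ (32 * D₂), ?_⟩, ⟨?_, max D₂ (D₁ * 32), ?_⟩⟩
  · ext f
    constructor
    · rintro ⟨-, h⟩
      exact ⟨LimitingInterpolation.exists_isRepresentation_of_jNorm_lt_top i₀ j (l21 f h), l21 f h⟩
    · rintro ⟨-, h⟩
      have h1 := l13 f (hmem f h) (l32 f h)
      exact ⟨LimitingInterpolation.exists_isRepresentation_of_jNorm_lt_top i₀ i₁ h1, h1⟩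
  · rintro f ⟨-, h⟩
    have hf := hmem f (l21 f h)
    constructor
    · calc N₁ f ≤ (32 : ℝ≥0) * (D₂ * N₂ f) := (h13 f hf).trans (by gcongr; exact h32 f)
        _ = ((32 * D₂ : ℝ≥0) : ℝ≥0∞) * N₂ f := by rw [ENNReal.coe_mul, mul_assoc]
        _ ≤ _ := mul_le_mul_left (ENNReal.coe_le_coe.2 (le_max_right _ _)) _
    · exact (h21 f).trans (mul_le_mul_left (ENNReal.coe_le_coe.2 (le_max_left _ _)) _)
  · ext f
    constructor
    · rintro ⟨-, h⟩
      exact ⟨hmem f h, l32 f h⟩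
    · rintro ⟨hf, h⟩
      have h2 := l21 f (l13 f hf h)
      exact ⟨LimitingInterpolation.exists_isRepresentation_of_jNorm_lt_top i₀ j h2, h2⟩
  · rintro f ⟨-, h⟩
    have hf := hmem f h
    constructor
    · calc N₂ f ≤ D₁ * ((32 : ℝ≥0) * N₃ f) := (h21 f).trans (by gcongr; exact h13 f hf)
        _ = ((D₁ * 32 : ℝ≥0) : ℝ≥0∞) * N₃ f := by rw [ENNReal.coe_mul, mul_assoc]
        _ ≤ _ := mul_le_mul_left (ENNReal.coe_le_coe.2 (le_max_right _ _)) _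
    · exact (h32 f).trans (mul_le_mul_left (ENNReal.coe_le_coe.2 (le_max_left _ _)) _)
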